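/- **Setting.** Let $\mathfrak z$ be a Euclidean space of dimension $n$ and let $\mathrm{Cl}(\mathfrak z)$ be its Clifford algebra with the convention $Z\cdot Z=-\|Z\|^2$. Let $\mathfrak v\neq 0$ be a finite-dimensional orthogonal $\mathrm{Cl}(\mathfrak z)$-module, i.e. a real $\mathrm{Cl}(\mathfrak z)$-module with a scalar product for which $\langle Z\bullet S,\tilde S\rangle=-\langle S,Z\bullet\tilde S\rangle$ for all $Z\in\mathfrak z$ and $S,\tilde S\in\mathfrak v$. Put $\mathfrak n=\mathfrak z\oplus\mathfrak v$. For $X=X_{\mathfrak z}\oplus X_{\mathfrak v}\in\mathfrak n$ define the skew-symmetric operator $\hat K(X)\colon\mathfrak z\to\mathfrak z$ by $$\langle\hat K(X)Z_1,Z_2\rangle=\langle Z_1\bullet X_{\mathfrak z}\bullet X_{\mathfrak v},\,Z_2\bullet X_{\mathfrak v}\rangle ,$$ and for $X\in D=\{X_{\mathfrak z}\ne0,\ X_{\mathfrak v}\neq0\}$ put $\check K(X)=\hat K(X)/(\|X_{\mathfrak z}\|\,\|X_{\mathfrak v}\|^2)$. Let $R\subseteq D$ be the complement of the ramification locus of $\check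 K^2$, i.e. the set of all $X\in D$ near which the number of distinct eigenvalues of $-\check K^2$ is constant. An *eigenvalue branch* on a connected component $U$ of $R$ is a real-analytic function $\mu\colon U\to\mathbb R$ such that $\mu(X)$ is an eigenvalue of $-\check K(X)^2$ for all $X\in U$. It has multiplicity $m$ if the corresponding eigenspace has dimension $m$ for every $X\in U$. A real number $\nu$ is a *global eigenvalue* of $-\check K^2$ if $\nu\|X_{\mathfrak z}\|^2\|X_{\mathfrak v}\|^4$ is an eigenvalue of $-\hat K(X)^2$ for all $X\in\mathfrak n$. Its multiplicity is the dimension of the $\nu$-eigenspace of $-\check K(X)^2$ for $X\in R$. A branch that is not identically $0$ is called nonzero. Let $\mathbb O$ be the octonions. By an *octonionic model* of $(\mathfrak z,\mathfrak v)$ we mean an isometric embedding of $\mathfrak z$ into $\operatorname{Im}\mathbb O$ together with an isometry $\mathfrak v\cong\mathbb O$ under which $Z\bullet S=SZ$. Let $R_E$ denote right multiplication by $E$. **Proposition 5.3.** The nonzero eigenvalue branches of $-\check K^2$ are as follows. 1. Let $n=4$. On each connected component $U$ of $R$ there is exactly one nonzero eigenvalue branch $\check\mu$. It is nonconstant and has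 multiplicity $2$. If $\mathfrak v$ is irreducible, then octonionic models exist, and in every octonionic model, for every orthonormal basis $E_1,E_2,E_3$ of the orthogonal complement of $\mathfrak z$ in $\operatorname{Im}\mathbb O$, with $I_1=R_{E_1}R_{E_2}$, $I_2=R_{E_2}R_{E_3}$, $I_3=R_{E_3}R_{E_1}$, $$\check\mu(S_0\oplus S_1)=\frac{\sum_{\alpha=1}^3\langle I_\alpha S_1,\,S_1S_0\rangle^2}{\|S_0\|^2\|S_1\|^4}.$$ 2. Let $n=5$. - If $\mathfrak v$ is irreducible, then $1$ is a global eigenvalue of $-\check K^2$ of multiplicity $2$, and on each connected component $U$ of $R$ the nonzero eigenvalue branches are the constant $1$ and one nonconstant branch $\check\mu$ of multiplicity $2$. Octonionic models exist, and in every octonionic model, for every orthonormal basis $E_1,E_2$ of the orthogonal complement of $\mathfrak z$ in $\operatorname{Im}\mathbb O$, with $J=R_{E_1}R_{E_2}$, $$\check\mu(S_0\oplus S_1)=\frac{\langle S_1S_0,\,JS_1\rangle^2}{\|S_0\|^2\|S_1\|^4}.$$ - If $\mathfrak v$ is the direct sum of two nontrivial $\mathrm{Cl}(\mathfrak z)$-submodules,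 then on each connected component of $R$ there are exactly two nonzero eigenvalue branches. They are distinct, nonconstant, and each has multiplicity $2$. 3. Let $n=6$. - If $\mathfrak v$ is irreducible, then $1$ is a global eigenvalue of $-\check K^2$ of multiplicity $4$, and on each connected component of $R$ the constant $1$ is the only nonzero eigenvalue branch. - If $\mathfrak v$ is the direct sum of two nontrivial $\mathrm{Cl}(\mathfrak z)$-submodules, then on each connected component of $R$ there are exactly two nonzero eigenvalue branches. They are distinct, nonconstant, and each has multiplicity $2$. -/

import Mathlib

open Topology
open scoped Quaternion

noncomputable section

/-! ### Orthogonal Clifford modules -/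

/-- The quadratic form `Z ↦ -‖Z‖²` on a Euclidean space `z`. Its Clifford algebra is `Cl(z)`
with the sign convention `Z * Z = -‖Z‖²`. -/
def cliffordForm (z : Type*) [NormedAddCommGroup z] [InnerProductSpace ℝ z] :
    QuadraticForm ℝ z :=
  -(LinearMap.BilinMap.toQuadraticMap (innerₗ z))

theorem cliffordForm_apply {z : Type*} [NormedAddCommGroup z] [InnerProductSpace ℝ z] (Z : z) :
    cliffordForm z Z = -‖Z‖ ^ 2 := by
  simp [cliffordForm]

/-- The real Clifford algebra `Cl(z)`. -/
abbrev Cl (z : Type*) [NormedAddCommGroup z] [InnerProductSpace ℝ z] : Type _ :=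
  CliffordAlgebra (cliffordForm z)

section
variable {z v : Type*} [NormedAddCommGroup z] [InnerProductSpace ℝ z]
  [NormedAddCommGroup v] [InnerProductSpace ℝ v] [Module (Cl z) v] [IsScalarTower ℝ (Cl z) v]

/-- Clifford multiplication `Z • S` of a vector `Z : z` with an element `S` of the
`Cl(z)`-module `v`, as a bilinear map. -/
def cliffMul : z →ₗ[ℝ] v →ₗ[ℝ] v :=
  (Algebra.lsmul ℝ ℝ v : Cl z →ₐ[ℝ] Module.End ℝ v).toLinearMap ∘ₗ
    CliffordAlgebra.ι (cliffordForm z)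

theorem cliffMul_apply (Z : z) (S : v) :
    cliffMul Z S = CliffordAlgebra.ι (cliffordForm z) Z • S := rfl

theorem cliffMul_cliffMul (Z : z) (S : v) : cliffMul Z (cliffMul Z S) = -(‖Z‖ ^ 2 • S) := by
  rw [cliffMul_apply, cliffMul_apply, smul_smul, CliffordAlgebra.ι_sq_scalar,
    cliffordForm_apply, algebraMap_smul, neg_smul]

end

/-- A `Cl(z)`-module `v` with a scalar product is orthogonal if Clifford multiplication by every
vector is skew-symmetric. -/
class IsOrthogonalCliffordModule (z v : Type*) [NormedAddCommGroup z] [InnerProductSpace ℝ z]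
    [NormedAddCommGroup v] [InnerProductSpace ℝ v] [Module (Cl z) v]
    [IsScalarTower ℝ (Cl z) v] : Prop where
  inner_cliffMul_left : ∀ (Z : z) (S T : v),
    inner ℝ (cliffMul Z S) T = -inner ℝ S (cliffMul Z T)

/-! ### The operator families on `z ⊕ v`

Elements of the sum `z ⊕ v` are written as pairs `X = (X.1, X.2)`; only the topology and the
real-analytic structure of `z × v` matter, which are those of the orthogonal sum. -/

section
variable {z v : Type*} [NormedAddCommGroup z] [InnerProductSpace ℝ z] [FiniteDimensional ℝ z]
  [NormedAddCommGroup v] [InnerProductSpace ℝ v] [FiniteDimensional ℝ v]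
  [Module (Cl z) v] [IsScalarTower ℝ (Cl z) v]

/-- The linear map `Z ↦ Z • S` from `z` to `v`. -/
def cliffOn (S : v) : z →ₗ[ℝ] v := (cliffMul : z →ₗ[ℝ] v →ₗ[ℝ] v).flip S

/-- The operator `K̂(X) : z → z` with `⟪K̂(X) Z₁, Z₂⟫ = ⟪Z₁ • X_z • X_v, Z₂ • X_v⟫`. -/
def kHat (X : z × v) : Module.End ℝ z :=
  LinearMap.adjoint (cliffOn X.2 : z →ₗ[ℝ] v) ∘ₗ cliffOn (cliffMul X.1 X.2)

theorem inner_kHat (X : z × v) (Z₁ Z₂ : z) :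
    inner ℝ (kHat X Z₁) Z₂ =
      inner ℝ (cliffMul Z₁ (cliffMul X.1 X.2)) (cliffMul Z₂ X.2) := by
  simp [kHat, cliffOn, LinearMap.adjoint_inner_left]

/-- The rescaled operator `Ǩ(X) = K̂(X) / (‖X_z‖ ‖X_v‖²)`, meaningful for `X_z ≠ 0`, `X_v ≠ 0`. -/
def kCheck (X : z × v) : Module.End ℝ z := (‖X.1‖ * ‖X.2‖ ^ 2)⁻¹ • kHat X

/-- The operator `-K̂(X)²`. -/
def negKHatSq (X : z × v) : Module.End ℝ z := -(kHat X * kHat X)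

/-- The operator `-Ǩ(X)²`. -/
def negKCheckSq (X : z × v) : Module.End ℝ z := -(kCheck X * kCheck X)

/-- The number of distinct eigenvalues of `-Ǩ(X)²`. -/
def numEigenvalues (X : z × v) : ℕ := {r : ℝ | (negKCheckSq X).HasEigenvalue r}.ncard

variable (z v) in
/-- The complement of the ramification locus of `Ǩ²` in its domain `{X_z ≠ 0, X_v ≠ 0}`: the
largest open set on which the number of distinct eigenvalues of `-Ǩ²` (equivalently, the
multiplicities of the eigenvalues) is locally constant. -/
def regularSet : Set (z × v) :=
  {X | X.1 ≠ 0 ∧ X.2 ≠ 0 ∧ ∀ᶠ Y in 𝓝 X, numEigenvalues Y = numEigenvalues X}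

/-- `U` is a connected component of the complement of the ramification locus. -/
def IsRegularComponent (U : Set (z × v)) : Prop :=
  ∃ X ∈ regularSet z v, U = connectedComponentIn (regularSet z v) X

/-- An eigenvalue branch of `-Ǩ²` on `U`: a real-analytic function `μ` on `U` such that `μ(X)` is
an eigenvalue of `-Ǩ(X)²` for every `X ∈ U`. -/
structure IsEigenvalueBranch (U : Set (z × v)) (μ : U → ℝ) : Prop where
  hasEigenvalue : ∀ X : U, (negKCheckSq (X : z × v)).HasEigenvalue (μ X)
  analytic : ∃ f : z × v → ℝ, AnalyticOnNhd ℝ f U ∧ ∀ X : U, f X = μ X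

/-- The eigenvalue branches on `U` other than the constant branch `0`. -/
def nonzeroBranches (U : Set (z × v)) : Set (U → ℝ) := {μ | IsEigenvalueBranch U μ ∧ μ ≠ 0}

/-- The branch `μ` has multiplicity `m` (at every point of `U`). -/
def HasMultiplicity (U : Set (z × v)) (μ : U → ℝ) (m : ℕ) : Prop :=
  ∀ X : U, Module.finrank ℝ ((negKCheckSq (X : z × v)).eigenspace (μ X)) = m

/-- The function `μ` on `U` is not constant. -/
def IsNonconstant (U : Set (z × v)) (μ : U → ℝ) : Prop := ¬ ∃ c : ℝ, ∀ X : U, μ X = c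

variable (z v) in
/-- `ν` is a global eigenvalue of `-Ǩ²`: `ν ‖X_z‖² ‖X_v‖⁴` is an eigenvalue of `-K̂(X)²` for
all `X`. -/
def IsGlobalEigenvalue (ν : ℝ) : Prop :=
  ∀ X : z × v, (negKHatSq X).HasEigenvalue (ν * (‖X.1‖ ^ 2 * ‖X.2‖ ^ 4))

variable (z v) in
/-- The global eigenvalue `ν` has multiplicity `m` off the ramification locus. -/
def IsGlobalEigenvalueOfMultiplicity (ν : ℝ) (m : ℕ) : Prop :=
  IsGlobalEigenvalue z v ν ∧
    ∀ X ∈ regularSet z v, Module.finrank ℝ ((negKCheckSq X).eigenspace ν) = m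

variable (z v) in
/-- The `Cl(z)`-module `v` is the direct sum of two nontrivial submodules. -/
def IsSplitModule : Prop :=
  ∃ v₁ v₂ : Submodule (Cl z) v, v₁ ≠ ⊥ ∧ v₂ ≠ ⊥ ∧ IsCompl v₁ v₂

end

/-! ### Octonions -/

/-- The octonions as pairs of quaternions, with the Euclidean scalar product. -/
abbrev Octonion : Type := WithLp 2 (ℍ[ℝ] × ℍ[ℝ])

/-- The octonionic product, by the Cayley-Dickson formula
`(a, b) (c, d) = (a c - d̄ b, d a + b c̄)`. -/
def octMul (x y : Octonion) : Octonion :=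
  WithLp.toLp 2 (x.fst * y.fst - star y.snd * x.snd, y.snd * x.fst + x.snd * star y.fst)

/-- Purely imaginary octonions. -/
def IsImOctonion (x : Octonion) : Prop := x.fst.re = 0

section
variable {z v : Type*} [NormedAddCommGroup z] [InnerProductSpace ℝ z]
  [NormedAddCommGroup v] [InnerProductSpace ℝ v] [Module (Cl z) v] [IsScalarTower ℝ (Cl z) v]

/-- An octonionic model of the pair `(z, v)`: an isometric identification of `z` with a subspace of
the imaginary octonions and of `v` with the octonions, under which Clifford multiplication becomes
right multiplication, `Z • S = S Z`. -/
structure IsOctonionModel (φ : z →ₗᵢ[ℝ] Octonion) (ψ : v ≃ₗᵢ[ℝ] Octonion) : Prop where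
  isIm : ∀ Z : z, IsImOctonion (φ Z)
  map_cliffMul : ∀ (Z : z) (S : v), ψ (cliffMul Z S) = octMul (ψ S) (φ Z)

/-- `E` is an orthonormal family in the orthogonal complement of `φ(z)` in the imaginary octonions.
(An orthonormal basis of it if the cardinality of `ι` is `7 - dim z`.) -/
def IsComplementFrame {ι : Type*} (φ : z →ₗᵢ[ℝ] Octonion) (E : ι → Octonion) : Prop :=
  Orthonormal ℝ E ∧ ∀ i, IsImOctonion (E i) ∧ ∀ Z : z, inner ℝ (E i) (φ Z) = 0

/-- The composition `R_A R_B` of right multiplications, `S ↦ (S B) A`. -/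
def rightMul₂ (A B S : Octonion) : Octonion := octMul (octMul S B) A

/-- `μ̂(S₀ ⊕ S₁) = ∑ ⟪I_α S₁, S₁ S₀⟫²` with `I₁ = R_{E₁} R_{E₂}`, `I₂ = R_{E₂} R_{E₃}`,
`I₃ = R_{E₃} R_{E₁}`. -/
def muHatFour (φ : z →ₗᵢ[ℝ] Octonion) (ψ : v ≃ₗᵢ[ℝ] Octonion) (E : Fin 3 → Octonion)
    (X : z × v) : ℝ :=
  inner ℝ (rightMul₂ (E 0) (E 1) (ψ X.2)) (octMul (ψ X.2) (φ X.1)) ^ 2 +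
    inner ℝ (rightMul₂ (E 1) (E 2) (ψ X.2)) (octMul (ψ X.2) (φ X.1)) ^ 2 +
    inner ℝ (rightMul₂ (E 2) (E 0) (ψ X.2)) (octMul (ψ X.2) (φ X.1)) ^ 2

/-- `μ̂(S₀ ⊕ S₁) = ⟪S₁ S₀, J S₁⟫²` with `J = R_{E₁} R_{E₂}`. -/
def muHatFive (φ : z →ₗᵢ[ℝ] Octonion) (ψ : v ≃ₗᵢ[ℝ] Octonion) (E : Fin 2 → Octonion)
    (X : z × v) : ℝ :=
  inner ℝ (octMul (ψ X.2) (φ X.1)) (rightMul₂ (E 0) (E 1) (ψ X.2)) ^ 2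

/-- The rescaling `μ̌(X) = μ̂(X) / (‖X_z‖² ‖X_v‖⁴)`, restricted to `U`. -/
def rescaled (U : Set (z × v)) (f : z × v → ℝ) (X : U) : ℝ :=
  f X / (‖(X : z × v).1‖ ^ 2 * ‖(X : z × v).2‖ ^ 4)

end

end

/-! The operator `kHat X` is skew and kills `X.1`, so `0` is always an eigenvalue of its negated
square, while every nonzero eigenvalue is positive and has even multiplicity. In dimension at most
six this leaves room for at most two pairs `s, s, t, t`, and in dimension four for one
(`exists_double_spectrum`, `exists_spectrum`). Let `N = nHat X`, `p = pHat X` and `q = qHat X`. Then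
`s + t = p / N` and `s * t = q / N ^ 2`, and `N`, `p`, `q` are analytic on the whole of `z × v`.

The analytic part follows from this. In dimension at most six, three distinct eigenvalues occur
exactly where `q * (p ^ 2 - 4 * q) ≠ 0`; in dimension four, two distinct eigenvalues occur exactly
where `p ≠ 0`. If such a function is nonzero at one point, the identity theorem makes it nonzero on
a dense set, and local constancy of the number of eigenvalues makes it nonzero at every regular
point. On a component the nonzero eigenvalues are then given by disjoint analytic branches, and
connectedness forces any other branch to coincide with one of them. A constant branch on an open set
would impose an identity between `N`, `p`, `q` on all of `z × v`. Thus everything reduces to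
evaluating `p` and `q` at a few points.

The algebraic part supplies these values. Commuting involutions, each a product of three Clifford
generators, have a common eigenvector in every nonzero invariant subspace, and its orbit is a copy
of the octonions on which `z` acts by right multiplication (`exists_octonion_intertwiner`). There
the entries of `kHat` are values of `octForm`, which is defined on all imaginary octonions. Parseval
over a full imaginary frame, split along `z` and its complement, turns the trace over `z` into a
multiple of `N` plus a sum over the complement (`sum_sum_octForm_sq`, `IsOctonionCopy.pHat_map`). On
the octonions this gives `p = muHatFour` for `n = 4`, `p = N + muHatFive` for `n = 5` and `p = 2 *
N` for `n = 6`. The same expansion gives `s, t ≤ 1`, hence `s = t = 1` for `n = 6`; for `n = 5` a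
dimension count produces a vector attaining the bound, hence the eigenvalue `1`. A split module
contains two orthogonal copies of the octonions, whose forms add up, and two explicit points suffice
(`exists_separating_points`). -/

/-! ### Spectrum of the square of a skew-symmetric operator -/

section SkewOperators

open Module

variable {E : Type*} [NormedAddCommGroup E] [InnerProductSpace ℝ E] [FiniteDimensional ℝ E]

omit [FiniteDimensional ℝ E] in
theorem isSymmetric_neg_mul_self {K : End ℝ E}
    (hK : ∀ x y : E, inner ℝ (K x) y = -inner ℝ x (K y)) : (-(K * K)).IsSymmetric := by
  intro x y
  simp [hK]

omit [FiniteDimensional ℝ E] in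
theorem inner_neg_mul_self {K : End ℝ E}
    (hK : ∀ x y : E, inner ℝ (K x) y = -inner ℝ x (K y)) (x y : E) :
    inner ℝ ((-(K * K)) x) y = inner ℝ (K x) (K y) := by
  simp [hK]

/-- Used with `f = 1`, `A` and `A * A`, so that one diagonalization yields the dimension count and
both power sums of the eigenvalues. -/
theorem trace_eq_sum_eigenvalues {A : End ℝ E} (hA : A.IsSymmetric) (f : End ℝ E) (g : ℝ → ℝ)
    (hf : ∀ r, ∀ x ∈ A.eigenspace r, f x = g r • x) :
    LinearMap.trace ℝ E f =
      ∑ μ : End.Eigenvalues A, g (μ : ℝ) * (finrank ℝ (A.eigenspace (μ : ℝ)) : ℝ) := by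
  have hmaps : ∀ μ : End.Eigenvalues A,
      Set.MapsTo f (A.eigenspace (μ : ℝ)) (A.eigenspace (μ : ℝ)) := by
    intro μ x hx
    have := hf _ x hx
    simp only [SetLike.mem_coe] at hx ⊢
    rw [this]
    exact Submodule.smul_mem _ _ hx
  rw [LinearMap.trace_eq_sum_trace_restrict hA.direct_sum_isInternal hmaps]
  refine Finset.sum_congr rfl fun μ _ => ?_
  have : f.restrict (hmaps μ) = g (μ : ℝ) • LinearMap.id := by
    ext x
    exact hf _ x x.2
  rw [this]
  simp

/-- `K` preserves the eigenspace and restricts to an operator `J` with `J * J = -r`. Its determinant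
squared is `(-r) ^ m`, which would be negative for odd `m`. -/
theorem even_finrank_eigenspace {K : End ℝ E} {r : ℝ} (hr : 0 < r) :
    Even (finrank ℝ ((-(K * K)).eigenspace r)) := by
  have hmaps : ∀ x ∈ (-(K * K)).eigenspace r, K x ∈ (-(K * K)).eigenspace r := by
    intro x hx
    rw [End.mem_eigenspace_iff] at hx ⊢
    have := congrArg K hx
    simpa using this
  set J := K.restrict hmaps
  have hJ : J * J = (-r) • LinearMap.id := by
    ext x
    have := End.mem_eigenspace_iff.1 x.2
    simp only [LinearMap.neg_apply, End.mul_apply] at this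
    simp [J, LinearMap.restrict_apply, ← this]
  have hdet : LinearMap.det J * LinearMap.det J =
      (-r) ^ finrank ℝ ((-(K * K)).eigenspace r) := by
    rw [← map_mul, hJ, LinearMap.det_smul]
    simp
  by_contra hodd
  rw [Nat.not_even_iff_odd] at hodd
  have := hodd.pow_neg (neg_lt_zero.2 hr)
  nlinarith [mul_self_nonneg (LinearMap.det J)]

/-- The square of a skew-symmetric operator with nontrivial kernel, in dimension at most six, has
at most two nonzero eigenvalues, which are of multiplicity two if they are distinct. -/
theorem exists_double_spectrum {K : End ℝ E}
    (hK : ∀ x y : E, inner ℝ (K x) y = -inner ℝ x (K y)) {y : E} (hy : y ≠ 0) (hKy : K y = 0)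
    (hn : finrank ℝ E ≤ 6) :
    ∃ s t : ℝ, 0 ≤ s ∧ 0 ≤ t ∧ (finrank ℝ E ≤ 4 → t = 0) ∧
      LinearMap.trace ℝ E (-(K * K)) = 2 * (s + t) ∧
      LinearMap.trace ℝ E (-(K * K) * -(K * K)) = 2 * (s ^ 2 + t ^ 2) ∧
      ∀ r, r ≠ 0 → finrank ℝ ((-(K * K)).eigenspace r) =
        (if r = s then 2 else 0) + (if r = t then 2 else 0) := by
  classical
  have hA := isSymmetric_neg_mul_self hK
  have hpos : ∀ r, (-(K * K)).HasEigenvalue r → 0 ≤ r := by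
    intro r hr
    obtain ⟨x, hx⟩ := hr.exists_hasEigenvector
    have h1 := inner_neg_mul_self hK x x
    rw [hx.apply_eq_smul, real_inner_smul_left] at h1
    have h2 : 0 < inner ℝ x x := real_inner_self_pos.2 hx.2
    have h3 : 0 ≤ inner ℝ (K x) (K x) := real_inner_self_nonneg
    by_contra hneg
    nlinarith
  set A := -(K * K) with hAdef
  set m : ℝ → ℕ := fun r => finrank ℝ (A.eigenspace r) with hm
  set τ : Finset ℝ := Finset.univ.image (fun μ : End.Eigenvalues A => (μ : ℝ)) with hτ
  have hmem : ∀ r, r ∈ τ ↔ A.HasEigenvalue r := by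
    intro r
    simp only [hτ, Finset.mem_image, Finset.mem_univ, true_and]
    exact ⟨fun ⟨μ, h⟩ => h ▸ μ.2, fun h => ⟨⟨r, h⟩, rfl⟩⟩
  have hsum : ∀ (f : End ℝ E) (g : ℝ → ℝ), (∀ r, ∀ x ∈ A.eigenspace r, f x = g r • x) →
      LinearMap.trace ℝ E f = ∑ r ∈ τ, g r * (m r : ℝ) := by
    intro f g hf
    rw [trace_eq_sum_eigenvalues hA f g hf, hτ, Finset.sum_image]
    exact fun a _ b _ h => Subtype.ext h
  have h0 : (0 : ℝ) ∈ τ := by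
    rw [hmem]
    refine End.hasEigenvalue_of_hasEigenvector (x := y) ⟨?_, hy⟩
    rw [End.mem_eigenspace_iff]
    simp [hAdef, hKy]
  have hm0 : ∀ r, A.HasEigenvalue r → 1 ≤ m r := by
    intro r hr
    exact Nat.one_le_iff_ne_zero.2 fun h => hr (Submodule.finrank_eq_zero.1 h)
  have hm0' : ∀ r, ¬ A.HasEigenvalue r → m r = 0 := by
    intro r hr
    have : A.eigenspace r = ⊥ := by simpa [End.HasEigenvalue, End.HasUnifEigenvalue] using hr
    simp [hm, this]
  set σ := τ.erase 0 with hσ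
  have hsplit : ∀ g : ℝ → ℝ, ∑ r ∈ τ, g r * (m r : ℝ) =
      g 0 * m 0 + ∑ r ∈ σ, g r * (m r : ℝ) := fun g =>
    (Finset.add_sum_erase τ _ h0).symm
  have hone : (finrank ℝ E : ℝ) = m 0 + ∑ r ∈ σ, (m r : ℝ) := by
    have := hsum 1 (fun _ => 1) (by simp)
    rw [hsplit] at this
    simpa using this
  have htr : LinearMap.trace ℝ E A = ∑ r ∈ σ, r * (m r : ℝ) := by
    have := hsum A (fun r => r) (fun r x hx => End.mem_eigenspace_iff.1 hx)
    rw [hsplit] at this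
    simpa using this
  have htr2 : LinearMap.trace ℝ E (A * A) = ∑ r ∈ σ, r ^ 2 * (m r : ℝ) := by
    have := hsum (A * A) (fun r => r ^ 2) (fun r x hx => by
      have := End.mem_eigenspace_iff.1 hx
      simp [this, smul_smul, sq])
    rw [hsplit] at this
    simpa using this
  have hone' : finrank ℝ E = m 0 + ∑ r ∈ σ, m r := by exact_mod_cast hone
  have hm00 := hm0 0 ((hmem 0).1 h0)
  have hσm : ∀ r ∈ σ, 0 < r ∧ Even (m r) ∧ 2 ≤ m r := by
    intro r hr
    obtain ⟨hr0, hr1⟩ := Finset.mem_erase.1 hr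
    rw [hmem] at hr1
    have hrpos := lt_of_le_of_ne (hpos r hr1) hr0.symm
    have hev : Even (m r) := even_finrank_eigenspace hrpos
    refine ⟨hrpos, hev, ?_⟩
    have := hm0 r hr1
    obtain ⟨k, hk⟩ := hev
    omega
  have hσn : ∀ r, r ≠ 0 → r ∉ σ → m r = 0 := by
    intro r hr h
    refine hm0' r fun h' => h (Finset.mem_erase.2 ⟨hr, (hmem r).2 h'⟩)
  -- Each nonzero eigenvalue uses at least two dimensions and the kernel at least one, so six
  -- dimensions allow at most two nonzero eigenvalues.
  have hcard : σ.card * 2 ≤ ∑ r ∈ σ, m r := by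
    simpa using Finset.card_nsmul_le_sum σ m 2 fun r hr => (hσm r hr).2.2
  have hcard' : σ.card = 0 ∨ σ.card = 1 ∨ σ.card = 2 := by omega
  rcases hcard' with h | h | h
  · rw [Finset.card_eq_zero] at h
    rw [h] at htr htr2
    refine ⟨0, 0, le_rfl, le_rfl, fun _ => rfl, by simpa using htr, by simpa using htr2, ?_⟩
    intro r hr
    rw [if_neg hr]
    exact hσn r hr (by simp [h])
  · obtain ⟨a, ha⟩ := Finset.card_eq_one.1 h
    obtain ⟨hapos, ⟨k, hk⟩, ha2⟩ := hσm a (by simp [ha])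
    rw [ha] at htr htr2 hone'
    simp only [Finset.sum_singleton] at htr htr2 hone'
    have hk' : m a = 2 ∨ m a = 4 := by omega
    rcases hk' with hk' | hk'
    -- A missing pair is recorded as `0`. This is harmless, since multiplicities are only claimed
    -- for `r ≠ 0`.
    · refine ⟨a, 0, hapos.le, le_rfl, fun _ => rfl, ?_, ?_, ?_⟩
      · rw [htr, hk']; push_cast; ring
      · rw [htr2, hk']; push_cast; ring
      · intro r hr
        by_cases hra : r = a
        · subst hra; simpa [hr] using hk'
        · rw [if_neg hra, if_neg hr]
          exact hσn r hr (by simp [ha, hra])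
    -- Multiplicity four is a coincidence `s = t`, where the two indicator terms add up. It needs
    -- dimension at least five.
    · refine ⟨a, a, hapos.le, hapos.le, fun _ => by omega, ?_, ?_, ?_⟩
      · rw [htr, hk']; push_cast; ring
      · rw [htr2, hk']; push_cast; ring
      · intro r hr
        by_cases hra : r = a
        · subst hra; simpa using hk'
        · rw [if_neg hra]
          exact hσn r hr (by simp [ha, hra])
  · obtain ⟨a, b, hab, hσab⟩ := Finset.card_eq_two.1 h
    obtain ⟨hapos, ⟨k, hk⟩, ha2⟩ := hσm a (by simp [hσab])
    obtain ⟨hbpos, ⟨l, hl⟩, hb2⟩ := hσm b (by simp [hσab])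
    rw [hσab] at htr htr2 hone'
    rw [Finset.sum_pair hab] at htr htr2 hone'
    have hk' : m a = 2 := by omega
    have hl' : m b = 2 := by omega
    refine ⟨a, b, hapos.le, hbpos.le, fun _ => by omega, ?_, ?_, ?_⟩
    · rw [htr, hk', hl']; push_cast; ring
    · rw [htr2, hk', hl']; push_cast; ring
    · intro r hr
      by_cases hra : r = a
      · subst hra; simpa [hab] using hk'
      · by_cases hrb : r = b
        · subst hrb; simpa [hra] using hl'
        · rw [if_neg hra, if_neg hrb]
          exact hσn r hr (by simp [hσab, hra, hrb])

end SkewOperators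

/-! ### Octonion identities -/

section OctonionAlgebra

theorem octonion_ext {x y : Octonion} (h₁ : x.fst = y.fst) (h₂ : x.snd = y.snd) : x = y := by
  apply (WithLp.equiv 2 (ℍ[ℝ] × ℍ[ℝ])).injective
  exact Prod.ext h₁ h₂

theorem inner_octonion (x y : Octonion) :
    inner ℝ x y = x.fst.re * y.fst.re + x.fst.imI * y.fst.imI + x.fst.imJ * y.fst.imJ +
      x.fst.imK * y.fst.imK + (x.snd.re * y.snd.re + x.snd.imI * y.snd.imI +
      x.snd.imJ * y.snd.imJ + x.snd.imK * y.snd.imK) := by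
  rw [WithLp.prod_inner_apply, Quaternion.inner_def, Quaternion.inner_def]
  simp

@[simp] theorem octMul_fst (x y : Octonion) :
    (octMul x y).fst = x.fst * y.fst - star y.snd * x.snd := rfl

@[simp] theorem octMul_snd (x y : Octonion) :
    (octMul x y).snd = y.snd * x.fst + x.snd * star y.fst := rfl

theorem octMul_add (x y w : Octonion) : octMul x (y + w) = octMul x y + octMul x w := by
  apply octonion_ext <;> simp [mul_add, add_mul] <;> abel

theorem octMul_smul (x y : Octonion) (c : ℝ) : octMul x (c • y) = c • octMul x y := by
  apply octonion_ext <;> simp [smul_sub, smul_add]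

theorem inner_octMul_octMul_left (x a b : Octonion) :
    inner ℝ (octMul x a) (octMul x b) = inner ℝ x x * inner ℝ a b := by
  simp only [inner_octonion]
  simp
  ring

theorem inner_octMul_octMul_right (x y a : Octonion) :
    inner ℝ (octMul x a) (octMul y a) = inner ℝ x y * inner ℝ a a := by
  simp only [inner_octonion]
  simp
  ring

theorem inner_octMul_left_of_isIm (x y : Octonion) {a : Octonion} (ha : IsImOctonion a) :
    inner ℝ (octMul x a) y = -inner ℝ x (octMul y a) := by
  simp only [IsImOctonion] at ha
  simp only [inner_octonion]
  simp [ha]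
  ring

/-- Octonionic conjugation. -/
noncomputable def octConj (x : Octonion) : Octonion := WithLp.toLp 2 (star x.fst, -x.snd)

/-- The adjoint of left multiplication is left multiplication by the conjugate. This isolates the
last factor, to which Parseval is then applied. -/
theorem inner_octMul_right_eq (u x a : Octonion) :
    inner ℝ u (octMul x a) = inner ℝ (octMul (octConj x) u) a := by
  simp only [inner_octonion]
  simp [octConj]
  ring

theorem inner_octConj_self (x : Octonion) : inner ℝ (octConj x) (octConj x) = inner ℝ x x := by
  simp only [inner_octonion]
  simp [octConj]

/-- The octonionic unit. -/
noncomputable def octOne : Octonion := WithLp.toLp 2 (1, 0)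

theorem octMul_octOne (x : Octonion) : octMul x octOne = x := by
  apply octonion_ext <;> simp [octOne]

theorem inner_octOne_self : inner ℝ octOne octOne = (1 : ℝ) := by
  simp [octOne]

theorem inner_octOne_of_isIm {a : Octonion} (ha : IsImOctonion a) : inner ℝ octOne a = (0 : ℝ) := by
  simp only [IsImOctonion] at ha
  rw [inner_octonion]
  simp [octOne, ha]

theorem finrank_octonion : Module.finrank ℝ Octonion = 8 := by
  rw [LinearEquiv.finrank_eq (WithLp.linearEquiv 2 ℝ (ℍ[ℝ] × ℍ[ℝ])), Module.finrank_prod,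
    Quaternion.finrank_eq_four]

/-- The form `⟪(S Y) A, S B⟫` on the octonions. -/
noncomputable def octForm (S Y A B : Octonion) : ℝ := inner ℝ (octMul (octMul S Y) A) (octMul S B)

/-- By the polarized composition law the part symmetric in `A`, `B` is a multiple of `⟪S Y, S⟫`,
which vanishes for imaginary `Y`. This extends the skewness of `kHat` to all of the imaginary
octonions. -/
theorem octForm_swap (S Y : Octonion) {A B : Octonion} (hY : IsImOctonion Y) (hA : IsImOctonion A)
    (hB : IsImOctonion B) : octForm S Y A B = -octForm S Y B A := by
  simp only [IsImOctonion] at hA hB hY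
  simp only [octForm, inner_octonion]
  simp [hA, hB, hY]
  ring

theorem octForm_self (S : Octonion) {Y A : Octonion} (hY : IsImOctonion Y) (hA : IsImOctonion A) :
    octForm S Y A A = 0 := by
  have := octForm_swap S Y hY hA hA
  linarith

theorem sum_inner_octMul_sq {ι : Type*} [Fintype ι] (G : OrthonormalBasis ι ℝ Octonion)
    (u S : Octonion) :
    ∑ i, (inner ℝ u (octMul S (G i)) : ℝ) ^ 2 = inner ℝ S S * inner ℝ u u := by
  simp_rw [inner_octMul_right_eq]
  rw [← inner_octConj_self S, ← inner_octMul_octMul_left, real_inner_self_eq_norm_sq]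
  have := G.sum_sq_norm_inner_left (octMul (octConj S) u)
  simpa using this

/-- Expansion of the form along an orthonormal frame of the imaginary octonions. -/
theorem sum_octForm_sq {ι : Type*} [Fintype ι] (hcard : Fintype.card ι = 7) {G : ι → Octonion}
    (hG : Orthonormal ℝ G) (hIm : ∀ i, IsImOctonion (G i)) (S : Octonion) {Y A : Octonion}
    (hA : IsImOctonion A) :
    ∑ i, octForm S Y A (G i) ^ 2 =
      inner ℝ S S ^ 2 * (inner ℝ Y Y * inner ℝ A A - inner ℝ Y A ^ 2) := by
  classical
  -- Adjoining the unit completes the imaginary frame to an orthonormal basis of the octonions. Its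
  -- own term in Parseval is the square of `⟪S, S⟫ ⟪Y, A⟫`, the subtracted part of the formula.
  set H : Option ι → Octonion := fun o => o.elim octOne G with hH
  have hHon : Orthonormal ℝ H := by
    rw [orthonormal_iff_ite]
    rw [orthonormal_iff_ite] at hG
    rintro (_ | i) (_ | j)
    · simpa [hH] using inner_octOne_self
    · simpa [hH] using inner_octOne_of_isIm (hIm j)
    · have := inner_octOne_of_isIm (hIm i)
      rw [real_inner_comm] at this
      simpa [hH] using this
    · simpa [hH] using hG i j
  have hc : Fintype.card (Option ι) = Module.finrank ℝ Octonion := by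
    rw [finrank_octonion, Fintype.card_option, hcard]
  let B := (basisOfOrthonormalOfCardEqFinrank hHon hc).toOrthonormalBasis
    (by rw [coe_basisOfOrthonormalOfCardEqFinrank]; exact hHon)
  have hB : ∀ i, B i = H i := by
    intro i
    simp [B]
  have h1 := sum_inner_octMul_sq B (octMul (octMul S Y) A) S
  simp only [hB] at h1
  rw [Fintype.sum_option] at h1
  have h2 : inner ℝ (octMul (octMul S Y) A) (octMul S (H none)) = -(inner ℝ S S * inner ℝ Y A) := by
    simp only [hH, Option.elim_none]
    rw [octMul_octOne, inner_octMul_left_of_isIm _ _ hA, inner_octMul_octMul_left]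
  rw [h2, inner_octMul_octMul_right, inner_octMul_octMul_left] at h1
  simp only [hH, Option.elim_some] at h1
  simp only [octForm]
  linear_combination h1

/-- Splitting an orthonormal frame of the imaginary octonions in two parts, the sums of the squares
of the entries of the form over both parts determine each other. -/
theorem sum_sum_octForm_sq {ι κ : Type*} [Fintype ι] [Fintype κ]
    (hcard : Fintype.card ι + Fintype.card κ = 7) {b : ι → Octonion} {E : κ → Octonion}
    (hG : Orthonormal ℝ (Sum.elim b E)) (hb : ∀ i, IsImOctonion (b i))
    (hE : ∀ i, IsImOctonion (E i)) (S : Octonion) {Y : Octonion} (hY : IsImOctonion Y)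
    (hYb : ∑ i, (inner ℝ Y (b i) : ℝ) ^ 2 = inner ℝ Y Y) (hYE : ∀ i, inner ℝ Y (E i) = (0 : ℝ)) :
    ∑ i, ∑ j, octForm S Y (b i) (b j) ^ 2 =
      (Fintype.card ι - 1 - Fintype.card κ) * (inner ℝ Y Y * inner ℝ S S ^ 2) +
        ∑ i, ∑ j, octForm S Y (E i) (E j) ^ 2 := by
  have hIm : ∀ i, IsImOctonion (Sum.elim b E i) := by
    rintro (i | i)
    exacts [hb i, hE i]
  have hc : Fintype.card (ι ⊕ κ) = 7 := by rw [Fintype.card_sum, hcard]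
  have hbb : ∀ i, inner ℝ (b i) (b i) = (1 : ℝ) := by
    intro i
    have h : ‖b i‖ = 1 := hG.1 (Sum.inl i)
    rw [real_inner_self_eq_norm_sq, h, one_pow]
  have hEE : ∀ i, inner ℝ (E i) (E i) = (1 : ℝ) := by
    intro i
    have h : ‖E i‖ = 1 := hG.1 (Sum.inr i)
    rw [real_inner_self_eq_norm_sq, h, one_pow]
  have h1 : ∀ i, ∑ j, octForm S Y (b i) (b j) ^ 2 + ∑ j, octForm S Y (b i) (E j) ^ 2 =
      inner ℝ S S ^ 2 * (inner ℝ Y Y - inner ℝ Y (b i) ^ 2) := by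
    intro i
    have := sum_octForm_sq hc hG hIm S (Y := Y) (hb i)
    rw [Fintype.sum_sum_type, hbb] at this
    simpa using this
  have h2 : ∀ i, ∑ j, octForm S Y (E i) (b j) ^ 2 + ∑ j, octForm S Y (E i) (E j) ^ 2 =
      inner ℝ S S ^ 2 * inner ℝ Y Y := by
    intro i
    have := sum_octForm_sq hc hG hIm S (Y := Y) (hE i)
    rw [Fintype.sum_sum_type, hEE, hYE] at this
    simpa using this
  have h1s := Finset.sum_congr (rfl : (Finset.univ : Finset ι) = _) fun i _ => h1 i
  have h2s := Finset.sum_congr (rfl : (Finset.univ : Finset κ) = _) fun i _ => h2 i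
  rw [Finset.sum_add_distrib] at h1s h2s
  rw [← Finset.mul_sum, Finset.sum_sub_distrib, hYb] at h1s
  -- The mixed blocks agree by skewness, so subtracting the expansions over `E` from those over `b`
  -- eliminates them.
  have h3 : ∑ i, ∑ j, octForm S Y (b i) (E j) ^ 2 = ∑ i, ∑ j, octForm S Y (E i) (b j) ^ 2 := by
    rw [Finset.sum_comm]
    refine Finset.sum_congr rfl fun i _ => Finset.sum_congr rfl fun j _ => ?_
    rw [octForm_swap S Y hY (hb j) (hE i), neg_sq]
  simp only [Finset.sum_const, Finset.card_univ, nsmul_eq_mul] at h1s h2s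
  linear_combination h1s - h2s - h3

/-- The quaternion unit `i`. -/
def quatI : ℍ[ℝ] := ⟨0, 1, 0, 0⟩

/-- The quaternion unit `j`. -/
def quatJ : ℍ[ℝ] := ⟨0, 0, 1, 0⟩

/-- The quaternion unit `k`. -/
def quatK : ℍ[ℝ] := ⟨0, 0, 0, 1⟩

@[simp] theorem quatI_re : quatI.re = 0 := rfl

@[simp] theorem quatI_imI : quatI.imI = 1 := rfl

@[simp] theorem quatI_imJ : quatI.imJ = 0 := rfl

@[simp] theorem quatI_imK : quatI.imK = 0 := rfl

@[simp] theorem quatJ_re : quatJ.re = 0 := rfl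

@[simp] theorem quatJ_imI : quatJ.imI = 0 := rfl

@[simp] theorem quatJ_imJ : quatJ.imJ = 1 := rfl

@[simp] theorem quatJ_imK : quatJ.imK = 0 := rfl

@[simp] theorem quatK_re : quatK.re = 0 := rfl

@[simp] theorem quatK_imI : quatK.imI = 0 := rfl

@[simp] theorem quatK_imJ : quatK.imJ = 0 := rfl

@[simp] theorem quatK_imK : quatK.imK = 1 := rfl

@[simp] theorem star_quatI : star quatI = -quatI := by ext <;> simp

@[simp] theorem star_quatJ : star quatJ = -quatJ := by ext <;> simp

@[simp] theorem star_quatK : star quatK = -quatK := by ext <;> simp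

/-- The orthonormal basis `i, j, k, l, il, jl, kl` of the imaginary octonions. -/
noncomputable def imUnit : Fin 7 → Octonion :=
  ![WithLp.toLp 2 (quatI, 0), WithLp.toLp 2 (quatJ, 0),
    WithLp.toLp 2 (quatK, 0), WithLp.toLp 2 (0, 1), WithLp.toLp 2 (0, quatI),
    WithLp.toLp 2 (0, quatJ), WithLp.toLp 2 (0, quatK)]

theorem isImOctonion_imUnit (i : Fin 7) : IsImOctonion (imUnit i) := by
  fin_cases i <;> simp [imUnit, IsImOctonion]

theorem inner_imUnit (i : Fin 7) (x : Octonion) : inner ℝ (imUnit i) x =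
    ![x.fst.imI, x.fst.imJ, x.fst.imK, x.snd.re, x.snd.imI, x.snd.imJ, x.snd.imK] i := by
  rw [inner_octonion]
  fin_cases i <;> simp [imUnit]

theorem orthonormal_imUnit : Orthonormal ℝ imUnit := by
  rw [orthonormal_iff_ite]
  intro i j
  rw [inner_imUnit]
  fin_cases i <;> fin_cases j <;> simp [imUnit]

end OctonionAlgebra

/-! ### Systems of anticommuting skew-symmetric complex structures -/

section CliffordSystems

variable {V : Type*} [NormedAddCommGroup V] [InnerProductSpace ℝ V]

/-- Pairwise anticommuting skew-symmetric operators with square `-1`. -/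
structure IsCliffordSystem {ι : Type*} (e : ι → Module.End ℝ V) : Prop where
  sq : ∀ i x, e i (e i x) = -x
  anti : ∀ i j, i ≠ j → ∀ x, e i (e j x) = -e j (e i x)
  skew : ∀ i x y, inner ℝ (e i x) y = -inner ℝ x (e i y)

/-- `T` is an involution and `g` exchanges its two eigenspaces injectively. A vector of `W` is
either fixed by `T`, and then `g` moves it into the `-1` eigenspace, or has a nonzero component `x -
T x` there. -/
theorem inf_ker_add_one_ne_bot {W : Submodule ℝ V} (hW : W ≠ ⊥) {T g : Module.End ℝ V}
    (hT : ∀ x ∈ W, T x ∈ W) (hg : ∀ x ∈ W, g x ∈ W) (hTT : ∀ x, T (T x) = x)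
    (hTg : ∀ x, T (g x) = -g (T x)) (hgg : ∀ x, g (g x) = -x) :
    W ⊓ LinearMap.ker (T + 1) ≠ ⊥ := by
  obtain ⟨x, hx, hx0⟩ := Submodule.exists_mem_ne_zero_of_ne_bot hW
  by_cases h : T x = x
  · refine fun hbot => hx0 ?_
    have hmem : g x ∈ W ⊓ LinearMap.ker (T + 1) := ⟨hg x hx, by simp [hTg, h]⟩
    rw [hbot, Submodule.mem_bot] at hmem
    have := hgg x
    rw [hmem, map_zero] at this
    simpa using this.symm
  · refine fun hbot => h ?_
    have hmem : x - T x ∈ W ⊓ LinearMap.ker (T + 1) :=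
      ⟨W.sub_mem hx (hT x hx), by simp [hTT]⟩
    rw [hbot, Submodule.mem_bot] at hmem
    exact (sub_eq_zero.1 hmem).symm

namespace IsCliffordSystem

theorem anti_of_lt {n : ℕ} {e : Fin n → Module.End ℝ V} (he : IsCliffordSystem e) :
    ∀ i j, j < i → ∀ x, e i (e j x) = -e j (e i x) :=
  fun i j h => he.anti i j h.ne'

/-- A product of three distinct generators is an involution, and it anticommutes with any fourth
generator because three sign changes occur. -/
theorem inf_ker_ne_bot {n : ℕ} {e : Fin n → Module.End ℝ V} (he : IsCliffordSystem e)
    {W : Submodule ℝ V} (hW : W ≠ ⊥) {i j k l : Fin n} (hij : i ≠ j) (hik : i ≠ k) (hjk : j ≠ k)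
    (hi : l ≠ i) (hj : l ≠ j) (hk : l ≠ k)
    (hT : ∀ x ∈ W, e i (e j (e k x)) ∈ W) (hg : ∀ x ∈ W, e l x ∈ W) :
    W ⊓ LinearMap.ker (e i * e j * e k + 1) ≠ ⊥ := by
  refine inf_ker_add_one_ne_bot hW (g := e l) hT hg ?_ ?_ (he.sq l)
  · intro x
    simp only [Module.End.mul_apply]
    rw [he.anti k i hik.symm, he.anti k j hjk.symm]
    simp only [map_neg, he.sq, neg_neg]
    rw [he.anti j i hij.symm]
    simp only [map_neg, he.sq, neg_neg]
  · intro x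
    simp only [Module.End.mul_apply]
    rw [he.anti k l hk.symm, map_neg, he.anti j l hj.symm, map_neg, map_neg,
      he.anti i l hi.symm, neg_neg]

theorem eq_of_mem_ker {n : ℕ} {e : Fin n → Module.End ℝ V} (he : IsCliffordSystem e)
    {i j k : Fin n} {x : V} (hx : x ∈ LinearMap.ker (e i * e j * e k + 1)) :
    e j (e k x) = e i x := by
  have h : e i (e j (e k x)) + x = 0 := by simpa using hx
  have := congrArg (e i) h
  rw [map_add, he.sq, map_zero] at this
  exact (neg_add_eq_zero.1 this)

theorem mem_ker_of_commute {T g : Module.End ℝ V} (h : ∀ x, T (g x) = g (T x)) {x : V}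
    (hx : x ∈ LinearMap.ker (T + 1)) : g x ∈ LinearMap.ker (T + 1) := by
  have hx' : T x + x = 0 := by simpa using hx
  simp [h, ← map_add, hx']

theorem exists_special_four {e : Fin 4 → Module.End ℝ V} (he : IsCliffordSystem e)
    {W : Submodule ℝ V} (hW : W ≠ ⊥) (hinv : ∀ i, ∀ x ∈ W, e i x ∈ W) :
    ∃ s ∈ W, s ≠ 0 ∧ e 1 (e 0 s) = e 2 s := by
  have h1 := he.inf_ker_ne_bot hW (i := 2) (j := 1) (k := 0) (l := 3) (by decide) (by decide)
    (by decide) (by decide) (by decide) (by decide)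
    (fun x hx => hinv _ _ (hinv _ _ (hinv _ _ hx))) (fun x hx => hinv _ _ hx)
  obtain ⟨s, hs, hs0⟩ := Submodule.exists_mem_ne_zero_of_ne_bot h1
  exact ⟨s, hs.1, hs0, he.eq_of_mem_ker hs.2⟩

theorem exists_special_five {e : Fin 5 → Module.End ℝ V} (he : IsCliffordSystem e)
    {W : Submodule ℝ V} (hW : W ≠ ⊥) (hinv : ∀ i, ∀ x ∈ W, e i x ∈ W) :
    ∃ s ∈ W, s ≠ 0 ∧ e 1 (e 0 s) = e 2 s ∧ e 3 (e 0 s) = e 4 s := by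
  have h1 := he.inf_ker_ne_bot hW (i := 2) (j := 1) (k := 0) (l := 3) (by decide) (by decide)
    (by decide) (by decide) (by decide) (by decide)
    (fun x hx => hinv _ _ (hinv _ _ (hinv _ _ hx))) (fun x hx => hinv _ _ hx)
  have h2 := he.inf_ker_ne_bot h1 (i := 4) (j := 3) (k := 0) (l := 1) (by decide) (by decide)
    (by decide) (by decide) (by decide) (by decide)
    (fun x hx => ⟨hinv _ _ (hinv _ _ (hinv _ _ hx.1)),
      mem_ker_of_commute (g := e 4 * e 3 * e 0)
        (fun x => by simp [he.anti_of_lt, he.sq]) hx.2⟩)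
    (fun x hx => ⟨hinv _ _ hx.1, mem_ker_of_commute
      (fun x => by simp [he.anti_of_lt, he.sq]) hx.2⟩)
  obtain ⟨s, hs, hs0⟩ := Submodule.exists_mem_ne_zero_of_ne_bot h2
  exact ⟨s, hs.1.1, hs0, he.eq_of_mem_ker hs.1.2, he.eq_of_mem_ker hs.2⟩

/-- The index triples `{2,1,0}`, `{4,3,0}`, `{5,3,1}` meet pairwise in one index, so the three
involutions commute and the eigenspaces can be cut down successively. At each stage the auxiliary
generator (`3`, then `1`, then `0`) lies in all earlier triples, hence commutes with their products,
but not in the new one. -/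
theorem exists_special_six {e : Fin 6 → Module.End ℝ V} (he : IsCliffordSystem e)
    {W : Submodule ℝ V} (hW : W ≠ ⊥) (hinv : ∀ i, ∀ x ∈ W, e i x ∈ W) :
    ∃ s ∈ W, s ≠ 0 ∧ e 1 (e 0 s) = e 2 s ∧ e 3 (e 0 s) = e 4 s ∧ e 3 (e 1 s) = e 5 s := by
  have h1 := he.inf_ker_ne_bot hW (i := 2) (j := 1) (k := 0) (l := 3) (by decide) (by decide)
    (by decide) (by decide) (by decide) (by decide)
    (fun x hx => hinv _ _ (hinv _ _ (hinv _ _ hx))) (fun x hx => hinv _ _ hx)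
  have h2 := he.inf_ker_ne_bot h1 (i := 4) (j := 3) (k := 0) (l := 1) (by decide) (by decide)
    (by decide) (by decide) (by decide) (by decide)
    (fun x hx => ⟨hinv _ _ (hinv _ _ (hinv _ _ hx.1)),
      mem_ker_of_commute (g := e 4 * e 3 * e 0)
        (fun x => by simp [he.anti_of_lt, he.sq]) hx.2⟩)
    (fun x hx => ⟨hinv _ _ hx.1, mem_ker_of_commute
      (fun x => by simp [he.anti_of_lt, he.sq]) hx.2⟩)
  have h3 := he.inf_ker_ne_bot h2 (i := 5) (j := 3) (k := 1) (l := 0) (by decide) (by decide)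
    (by decide) (by decide) (by decide) (by decide)
    (fun x hx => ⟨⟨hinv _ _ (hinv _ _ (hinv _ _ hx.1.1)),
      mem_ker_of_commute (g := e 5 * e 3 * e 1)
        (fun x => by simp [he.anti_of_lt, he.sq]) hx.1.2⟩,
      mem_ker_of_commute (g := e 5 * e 3 * e 1)
        (fun x => by simp [he.anti_of_lt, he.sq]) hx.2⟩)
    (fun x hx => ⟨⟨hinv _ _ hx.1.1, mem_ker_of_commute
      (fun x => by simp [he.anti_of_lt, he.sq]) hx.1.2⟩, mem_ker_of_commute
      (fun x => by simp [he.anti_of_lt, he.sq]) hx.2⟩)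
  obtain ⟨s, hs, hs0⟩ := Submodule.exists_mem_ne_zero_of_ne_bot h3
  exact ⟨s, hs.1.1.1, hs0, he.eq_of_mem_ker hs.1.1.2, he.eq_of_mem_ker hs.1.2,
    he.eq_of_mem_ker hs.2⟩

end IsCliffordSystem

end CliffordSystems

/-! ### Octonionic coordinates on Clifford modules -/

section OctonionOrbit

variable {V : Type*} [NormedAddCommGroup V] [InnerProductSpace ℝ V]

/-- The map `a ↦ a₀ s + a₁ e₀ s + a₂ e₁ s + a₃ e₂ s` on the quaternions. -/
def quatOrbit (e : Fin 4 → Module.End ℝ V) (s : V) : ℍ[ℝ] →ₗ[ℝ] V where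
  toFun a := a.re • s + a.imI • e 0 s + a.imJ • e 1 s + a.imK • e 2 s
  map_add' a b := by
    simp only [Quaternion.re_add, Quaternion.imI_add, Quaternion.imJ_add, Quaternion.imK_add]
    module
  map_smul' c a := by
    simp only [Quaternion.re_smul, Quaternion.imI_smul, Quaternion.imJ_smul, Quaternion.imK_smul,
      smul_eq_mul, RingHom.id_apply]
    module

theorem quatOrbit_apply (e : Fin 4 → Module.End ℝ V) (s : V) (a : ℍ[ℝ]) :
    quatOrbit e s a = a.re • s + a.imI • e 0 s + a.imJ • e 1 s + a.imK • e 2 s := rfl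

/-- The map `(a, b) ↦ ρ a + e₃ (ρ b)` on the octonions, where `ρ = quatOrbit e s`. -/
noncomputable def octOrbit (e : Fin 4 → Module.End ℝ V) (s : V) : Octonion →ₗ[ℝ] V where
  toFun x := quatOrbit e s x.fst + e 3 (quatOrbit e s x.snd)
  map_add' x y := by simp; abel
  map_smul' c x := by simp

theorem octOrbit_apply (e : Fin 4 → Module.End ℝ V) (s : V) (x : Octonion) :
    octOrbit e s x = quatOrbit e s x.fst + e 3 (quatOrbit e s x.snd) := rfl

namespace IsCliffordSystem

variable {e : Fin 4 → Module.End ℝ V} (he : IsCliffordSystem e) {s : V}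
  (hs : e 1 (e 0 s) = e 2 s)

include he hs

/-- The single relation `e 1 (e 0 s) = e 2 s` makes the span of `s`, `e 0 s`, `e 1 s`, `e 2 s`
stable under the first three generators, with the multiplication table of the quaternions. -/
theorem orbit_table : e 0 (e 1 s) = -e 2 s ∧ e 0 (e 2 s) = e 1 s ∧ e 1 (e 2 s) = -e 0 s ∧
    e 2 (e 0 s) = -e 1 s ∧ e 2 (e 1 s) = e 0 s := by
  have h01 : e 0 (e 1 s) = -e 2 s := by rw [he.anti 0 1 (by decide), hs]
  have h02 : e 0 (e 2 s) = e 1 s := by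
    rw [← hs, he.anti 0 1 (by decide), he.sq]; simp
  have h12 : e 1 (e 2 s) = -e 0 s := by rw [← hs, he.sq]
  refine ⟨h01, h02, h12, ?_, ?_⟩
  · rw [he.anti 2 0 (by decide), h02]
  · rw [he.anti 2 1 (by decide), h12, neg_neg]

theorem apply_quatOrbit (a : ℍ[ℝ]) :
    e 0 (quatOrbit e s a) = quatOrbit e s (a * quatI) ∧
      e 1 (quatOrbit e s a) = quatOrbit e s (a * quatJ) ∧
      e 2 (quatOrbit e s a) = quatOrbit e s (a * quatK) := by
  obtain ⟨h01, h02, h12, h20, h21⟩ := he.orbit_table hs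
  simp only [quatOrbit_apply, map_add, map_smul, he.sq, h01, h02, h12, h20, h21, hs,
    Quaternion.re_mul, Quaternion.imI_mul, Quaternion.imJ_mul, Quaternion.imK_mul,
    quatI_re, quatI_imI, quatI_imJ, quatI_imK, quatJ_re, quatJ_imI, quatJ_imJ, quatJ_imK,
    quatK_re, quatK_imI, quatK_imJ, quatK_imK]
  refine ⟨?_, ?_, ?_⟩ <;> module

theorem apply_octOrbit (x : Octonion) (i : Fin 4) :
    e i (octOrbit e s x) = octOrbit e s (octMul x (imUnit (Fin.castLE (by decide) i))) := by
  obtain ⟨h0, h1, h2⟩ := he.apply_quatOrbit hs x.fst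
  obtain ⟨k0, k1, k2⟩ := he.apply_quatOrbit hs x.snd
  rw [octOrbit_apply, octOrbit_apply, octMul_fst, octMul_snd, map_add]
  fin_cases i
  · have := he.anti 0 3 (by decide) (quatOrbit e s x.snd)
    simp [imUnit, h0, k0, this]
  · have := he.anti 1 3 (by decide) (quatOrbit e s x.snd)
    simp [imUnit, h1, k1, this]
  · have := he.anti 2 3 (by decide) (quatOrbit e s x.snd)
    simp [imUnit, h2, k2, this]
  · simp [imUnit, he.sq]
    abel

/-- A further operator `f` anticommuting with the system acts on the orbit as the right
multiplication by `c l`, where `c` is a quaternion with `f s = e₃ (ρ c)`. -/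
theorem apply_octOrbit_of_anti {f : Module.End ℝ V} (hf : ∀ i x, f (e i x) = -e i (f x))
    {c : ℍ[ℝ]} (hc : star c = -c) (hfs : f s = e 3 (quatOrbit e s c)) (x : Octonion) :
    f (octOrbit e s x) = octOrbit e s (octMul x (WithLp.toLp 2 (0, c))) := by
  -- Moving `f` past `e 0`, `e 1`, `e 2` and then moving these past `e 3` costs two signs, so `f` is
  -- determined by its value at `s`.
  have key : ∀ a : ℍ[ℝ], f (quatOrbit e s a) = e 3 (quatOrbit e s (c * a)) := by
    intro a
    obtain ⟨h0, h1, h2⟩ := he.apply_quatOrbit hs c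
    have h3 : ∀ x, e 0 (e 3 x) = -e 3 (e 0 x) := he.anti 0 3 (by decide)
    have h4 : ∀ x, e 1 (e 3 x) = -e 3 (e 1 x) := he.anti 1 3 (by decide)
    have h5 : ∀ x, e 2 (e 3 x) = -e 3 (e 2 x) := he.anti 2 3 (by decide)
    have ha : c * a = a.re • c + a.imI • (c * quatI) + a.imJ • (c * quatJ) +
        a.imK • (c * quatK) := by
      ext <;> simp <;> ring
    rw [ha, quatOrbit_apply e s a]
    simp only [map_add, map_smul, hf, hfs, h3, h4, h5, h0, h1, h2, neg_neg]
  rw [octOrbit_apply, octOrbit_apply, octMul_fst, octMul_snd, map_add, hf, key, key, he.sq]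
  simp [hc]
  abel

theorem norm_octOrbit (hs1 : ‖s‖ = 1) (x : Octonion) : ‖octOrbit e s x‖ = ‖x‖ := by
  have hss : inner ℝ s s = (1 : ℝ) := by rw [real_inner_self_eq_norm_sq, hs1, one_pow]
  have hself : ∀ i y, inner ℝ y (e i y) = (0 : ℝ) := by
    intro i y
    have := he.skew i y y
    rw [real_inner_comm] at this
    linarith
  have hself' : ∀ i y, inner ℝ (e i y) y = (0 : ℝ) := by
    intro i y
    rw [real_inner_comm, hself]
  have hnorm : ∀ i y w, inner ℝ (e i y) (e i w) = (inner ℝ y w : ℝ) := by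
    intro i y w
    rw [he.skew, he.sq, inner_neg_right, neg_neg]
  have hcross : ∀ i j, i ≠ j → inner ℝ (e i s) (e j s) = (0 : ℝ) := by
    intro i j hij
    have h1 : inner ℝ (e i s) (e j s) = -inner ℝ s (e i (e j s)) := he.skew _ _ _
    have h2 : inner ℝ (e j s) (e i s) = -inner ℝ s (e j (e i s)) := he.skew _ _ _
    rw [he.anti i j hij, inner_neg_right] at h1
    rw [real_inner_comm] at h2
    linarith
  have hquat : ∀ a, inner ℝ (quatOrbit e s a) (quatOrbit e s a) =
      a.re ^ 2 + a.imI ^ 2 + a.imJ ^ 2 + a.imK ^ 2 := by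
    intro a
    simp only [quatOrbit_apply, inner_add_left, inner_add_right, real_inner_smul_left,
      real_inner_smul_right, hself, hself', hnorm, hss, hcross 0 1 (by decide),
      hcross 0 2 (by decide), hcross 1 0 (by decide), hcross 1 2 (by decide),
      hcross 2 0 (by decide), hcross 2 1 (by decide)]
    ring
  obtain ⟨h01, h02, h12, h20, h21⟩ := he.orbit_table hs
  have hinv : ∀ a, e 2 (e 1 (e 0 (quatOrbit e s a))) = -quatOrbit e s a := by
    intro a
    simp only [quatOrbit_apply, map_add, map_smul, map_neg, he.sq, h01, h02, h12, h20, h21, hs]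
    module
  -- The symmetric operator `e 2 * e 1 * e 0` acts as `-1` on the quaternionic orbit and as `+1` on
  -- its image under `e 3`, so the two are orthogonal.
  have horth : ∀ a b, inner ℝ (quatOrbit e s a) (e 3 (quatOrbit e s b)) = (0 : ℝ) := by
    intro a b
    have h1 : inner ℝ (e 2 (e 1 (e 0 (quatOrbit e s a)))) (e 3 (quatOrbit e s b)) =
        -inner ℝ (quatOrbit e s a) (e 3 (quatOrbit e s b)) := by rw [hinv, inner_neg_left]
    have h2 : e 0 (e 1 (e 2 (e 3 (quatOrbit e s b)))) = -e 3 (quatOrbit e s b) := by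
      have h3 : e 0 (e 1 (e 2 (quatOrbit e s b))) = quatOrbit e s b := by
        rw [he.anti 1 2 (by decide), map_neg, he.anti 0 2 (by decide),
          he.anti 0 1 (by decide), map_neg, hinv]
        simp
      rw [he.anti 2 3 (by decide), map_neg, he.anti 1 3 (by decide), neg_neg,
        he.anti 0 3 (by decide), h3]
    rw [he.skew, he.skew, he.skew, h2, inner_neg_right] at h1
    linarith
  have h : ‖octOrbit e s x‖ ^ 2 = ‖x‖ ^ 2 := by
    rw [← real_inner_self_eq_norm_sq, ← real_inner_self_eq_norm_sq, inner_octonion,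
      octOrbit_apply, inner_add_left, inner_add_right, inner_add_right, horth,
      real_inner_comm (quatOrbit e s x.fst) (e 3 _), horth, hnorm, hquat, hquat]
    ring
  exact (sq_eq_sq₀ (norm_nonneg _) (norm_nonneg _)).1 h

end IsCliffordSystem

end OctonionOrbit

section StandardModel

variable {z v : Type*} [NormedAddCommGroup z] [InnerProductSpace ℝ z]
  [NormedAddCommGroup v] [InnerProductSpace ℝ v] [Module (Cl z) v] [IsScalarTower ℝ (Cl z) v]

theorem cliffMul_anticomm (Z W : z) (S : v) : cliffMul Z (cliffMul W S) + cliffMul W (cliffMul Z S) =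
    -((2 * inner ℝ Z W : ℝ) • S) := by
  have h := cliffMul_cliffMul (Z + W) S
  have hn : ‖Z + W‖ ^ 2 = ‖Z‖ ^ 2 + 2 * inner ℝ Z W + ‖W‖ ^ 2 := norm_add_sq_real Z W
  simp only [map_add, LinearMap.add_apply, cliffMul_cliffMul, hn, add_smul] at h
  rw [eq_neg_iff_add_eq_zero, ← sub_eq_zero.2 h]
  abel

theorem isCliffordSystem_cliffMul [IsOrthogonalCliffordModule z v] {ι : Type*} {b : ι → z}
    (hb : Orthonormal ℝ b) :
    IsCliffordSystem (fun i => (cliffMul (b i) : Module.End ℝ v)) where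
  sq i x := by rw [cliffMul_cliffMul, hb.1 i]; simp
  anti i j hij x := by
    have := cliffMul_anticomm (b i) (b j) x
    rw [hb.2 hij] at this
    simpa using eq_neg_of_add_eq_zero_left (by simpa using this)
  skew i x y := IsOrthogonalCliffordModule.inner_cliffMul_left _ _ _

/-- The isometric embedding of `z` into the imaginary octonions that sends a given orthonormal basis
to the first standard units. -/
noncomputable def stdEmbedding {n : ℕ} (b : OrthonormalBasis (Fin n) ℝ z) (hn : n ≤ 7) :
    z →ₗᵢ[ℝ] Octonion :=
  (b.toBasis.constr ℝ fun i => imUnit (Fin.castLE hn i)).isometryOfOrthonormal (v := b.toBasis)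
    (by simp) (by
      have h : (b.toBasis.constr ℝ fun i => imUnit (Fin.castLE hn i)) ∘ b.toBasis =
          imUnit ∘ Fin.castLE hn := by
        funext i
        simp only [Function.comp_apply, Module.Basis.constr_basis]
      rw [h]
      exact orthonormal_imUnit.comp _ (Fin.castLE_injective hn))

theorem stdEmbedding_apply {n : ℕ} (b : OrthonormalBasis (Fin n) ℝ z) (hn : n ≤ 7) (i : Fin n) :
    stdEmbedding b hn (b i) = imUnit (Fin.castLE hn i) := by
  have h : stdEmbedding b hn (b i) =
      b.toBasis.constr ℝ (fun i => imUnit (Fin.castLE hn i)) (b i) := rfl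
  rw [h, ← b.coe_toBasis]
  exact b.toBasis.constr_basis ℝ _ i

theorem stdEmbedding_eq_sum {n : ℕ} (b : OrthonormalBasis (Fin n) ℝ z) (hn : n ≤ 7) (Z : z) :
    stdEmbedding b hn Z = ∑ i, (inner ℝ (b i) Z : ℝ) • imUnit (Fin.castLE hn i) := by
  conv_lhs => rw [← b.sum_repr' Z]
  simp [map_sum, stdEmbedding_apply]

theorem isImOctonion_stdEmbedding {n : ℕ} (b : OrthonormalBasis (Fin n) ℝ z) (hn : n ≤ 7) (Z : z) :
    IsImOctonion (stdEmbedding b hn Z) := by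
  have h : ∀ i, inner ℝ octOne (imUnit i) = (0 : ℝ) := fun i =>
    inner_octOne_of_isIm (isImOctonion_imUnit i)
  have h2 : inner ℝ octOne (stdEmbedding b hn Z) = (0 : ℝ) := by
    rw [stdEmbedding_eq_sum, inner_sum]
    exact Finset.sum_eq_zero fun i _ => by rw [real_inner_smul_right, h, mul_zero]
  rw [inner_octonion] at h2
  simpa [octOne, IsImOctonion] using h2

theorem inner_imUnit_stdEmbedding {n : ℕ} (b : OrthonormalBasis (Fin n) ℝ z) (hn : n ≤ 7)
    {i : Fin 7} (hi : n ≤ i) (Z : z) : inner ℝ (imUnit i) (stdEmbedding b hn Z) = (0 : ℝ) := by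
  rw [stdEmbedding_eq_sum, inner_sum]
  refine Finset.sum_eq_zero fun j _ => ?_
  rw [real_inner_smul_right, orthonormal_imUnit.2, mul_zero]
  intro h
  have h' := congrArg Fin.val h
  simp at h'
  omega

theorem cliffMul_of_basis {n : ℕ} (b : OrthonormalBasis (Fin n) ℝ z) (hn : n ≤ 7)
    (θ : Octonion →ₗ[ℝ] v)
    (h : ∀ i x, cliffMul (b i) (θ x) = θ (octMul x (imUnit (Fin.castLE hn i)))) (Z : z)
    (x : Octonion) : cliffMul Z (θ x) = θ (octMul x (stdEmbedding b hn Z)) := by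
  let R : Octonion →ₗ[ℝ] Octonion :=
    { toFun := octMul x, map_add' := octMul_add x, map_smul' := fun c y => octMul_smul x y c }
  have : (cliffMul : z →ₗ[ℝ] v →ₗ[ℝ] v).flip (θ x) =
      θ ∘ₗ R ∘ₗ (stdEmbedding b hn).toLinearMap := by
    refine b.toBasis.ext fun i => ?_
    simp [R, h, stdEmbedding_apply]
  exact LinearMap.congr_fun this Z

/-- Every nonzero invariant subspace of an orthogonal Clifford module over a space of dimension
four, five or six contains an isometric copy of the octonions, on which the basis vectors act by
right multiplication with the standard units. -/
theorem exists_octonion_intertwiner [IsOrthogonalCliffordModule z v] {n : ℕ}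
    (b : OrthonormalBasis (Fin n) ℝ z) (hn : n ≤ 7) (hn' : n = 4 ∨ n = 5 ∨ n = 6)
    {W : Submodule ℝ v} (hW : W ≠ ⊥) (hinv : ∀ Z : z, ∀ x ∈ W, cliffMul Z x ∈ W) :
    ∃ θ : Octonion →ₗᵢ[ℝ] v, (∀ x, θ x ∈ W) ∧
      ∀ Z x, cliffMul Z (θ x) = θ (octMul x (stdEmbedding b hn Z)) := by
  have he := isCliffordSystem_cliffMul (v := v) b.orthonormal
  have h4 : 4 ≤ n := by omega
  set e : Fin n → Module.End ℝ v := fun i => cliffMul (b i) with hedef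
  set e' : Fin 4 → Module.End ℝ v := fun i => e (Fin.castLE h4 i) with hedef'
  have he' : IsCliffordSystem e' := isCliffordSystem_cliffMul (v := v)
    (b.orthonormal.comp _ (Fin.castLE_injective h4))
  -- The first four generators already build the octonionic orbit of `s`. A further generator only
  -- has to agree at `s` with right multiplication by the corresponding unit `c l`; the unit `c` is
  -- `i` for index `4` and `j` for index `5`.
  suffices hmain : ∃ s ∈ W, s ≠ 0 ∧ e' 1 (e' 0 s) = e' 2 s ∧ ∀ i : Fin n, 4 ≤ (i : ℕ) →
      ∃ c : ℍ[ℝ], star c = -c ∧ e i s = e' 3 (quatOrbit e' s c) ∧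
        WithLp.toLp 2 (0, c) = imUnit (Fin.castLE hn i) by
    obtain ⟨s₀, hs₀, hs₀', h₀, h₀'⟩ := hmain
    set r : ℝ := ‖s₀‖⁻¹ with hr
    have hquat : ∀ c, quatOrbit e' (r • s₀) c = r • quatOrbit e' s₀ c := by
      intro c
      simp only [quatOrbit_apply, map_smul]
      module
    have hs1 : ‖r • s₀‖ = 1 := norm_smul_inv_norm hs₀'
    have hs2 : e' 1 (e' 0 (r • s₀)) = e' 2 (r • s₀) := by simp only [map_smul, h₀]
    refine ⟨⟨octOrbit e' (r • s₀), he'.norm_octOrbit hs2 hs1⟩, ?_, ?_⟩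
    · intro x
      have hq : ∀ a, quatOrbit e' (r • s₀) a ∈ W := by
        intro a
        have hs := W.smul_mem r hs₀
        rw [quatOrbit_apply]
        exact W.add_mem (W.add_mem (W.add_mem (W.smul_mem _ hs) (W.smul_mem _ (hinv _ _ hs)))
          (W.smul_mem _ (hinv _ _ hs))) (W.smul_mem _ (hinv _ _ hs))
      exact W.add_mem (hq _) (hinv _ _ (hq _))
    · refine cliffMul_of_basis b hn (octOrbit e' (r • s₀)) fun i x => ?_
      by_cases hi : (i : ℕ) < 4
      · exact he'.apply_octOrbit hs2 x ⟨i, hi⟩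
      · obtain ⟨c, hc, hic, hci⟩ := h₀' i (not_lt.1 hi)
        rw [← hci]
        refine he'.apply_octOrbit_of_anti hs2 (f := e i) (fun j y => ?_) hc ?_ x
        · refine he.anti i _ (fun h => hi ?_) y
          rw [h]
          exact j.2
        · rw [hquat, map_smul, map_smul, hic]
  have hinv' : ∀ i, ∀ x ∈ W, e i x ∈ W := fun i x hx => hinv _ _ hx
  have hq1 : ∀ s, quatOrbit e' s quatI = e' 0 s := fun s => by simp [quatOrbit_apply]
  have hq2 : ∀ s, quatOrbit e' s quatJ = e' 1 s := fun s => by simp [quatOrbit_apply]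
  rcases hn' with rfl | rfl | rfl
  · obtain ⟨s, hsW, hs0, h⟩ := he.exists_special_four hW hinv'
    exact ⟨s, hsW, hs0, h, fun i hi => by omega⟩
  · obtain ⟨s, hsW, hs0, h, h'⟩ := he.exists_special_five hW hinv'
    refine ⟨s, hsW, hs0, h, fun i hi => ?_⟩
    obtain rfl : i = 4 := by omega
    refine ⟨quatI, by simp, ?_, rfl⟩
    rw [hq1]
    exact h'.symm
  · obtain ⟨s, hsW, hs0, h, h', h''⟩ := he.exists_special_six hW hinv'
    refine ⟨s, hsW, hs0, h, fun i hi => ?_⟩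
    obtain rfl | rfl : i = 4 ∨ i = 5 := by omega
    · refine ⟨quatI, by simp, ?_, rfl⟩
      rw [hq1]
      exact h'.symm
    · refine ⟨quatJ, by simp, ?_, rfl⟩
      rw [hq2]
      exact h''.symm

end StandardModel

/-! ### The operators `K̂` and `Ǩ` -/

section KOperators

open Module

variable {z v : Type*} [NormedAddCommGroup z] [InnerProductSpace ℝ z] [FiniteDimensional ℝ z]
  [NormedAddCommGroup v] [InnerProductSpace ℝ v] [FiniteDimensional ℝ v]
  [Module (Cl z) v] [IsScalarTower ℝ (Cl z) v]

/-- The normalizing factor `‖X_z‖² ‖X_v‖⁴`. -/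
noncomputable def nHat (X : z × v) : ℝ := inner ℝ X.1 X.1 * inner ℝ X.2 X.2 ^ 2

/-- Half of the trace of `-K̂²`. -/
noncomputable def pHat (X : z × v) : ℝ := LinearMap.trace ℝ z (negKHatSq X) / 2

/-- Half of the second elementary symmetric function attached to the eigenvalues of `-K̂²`. -/
noncomputable def qHat (X : z × v) : ℝ :=
  (pHat X ^ 2 - LinearMap.trace ℝ z (negKHatSq X * negKHatSq X) / 2) / 2

omit [FiniteDimensional ℝ z] [FiniteDimensional ℝ v] [Module (Cl z) v]
  [IsScalarTower ℝ (Cl z) v] in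
theorem nHat_eq (X : z × v) : nHat X = ‖X.1‖ ^ 2 * ‖X.2‖ ^ 4 := by
  rw [nHat, real_inner_self_eq_norm_sq, real_inner_self_eq_norm_sq]
  ring

omit [FiniteDimensional ℝ z] [FiniteDimensional ℝ v] [Module (Cl z) v]
  [IsScalarTower ℝ (Cl z) v] in
theorem nHat_pos {X : z × v} (h₁ : X.1 ≠ 0) (h₂ : X.2 ≠ 0) : 0 < nHat X := by
  rw [nHat_eq]
  have := norm_pos_iff.2 h₁
  have := norm_pos_iff.2 h₂
  positivity

theorem trace_negKHatSq {ι : Type*} [Fintype ι] (b : OrthonormalBasis ι ℝ z)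
    (hskew : ∀ (X : z × v) A B, inner ℝ (kHat X A) B = -inner ℝ A (kHat X B)) (X : z × v) :
    LinearMap.trace ℝ z (negKHatSq X) = ∑ i, ∑ j, inner ℝ (kHat X (b i)) (b j) ^ 2 := by
  rw [LinearMap.trace_eq_sum_inner _ b]
  refine Finset.sum_congr rfl fun i _ => ?_
  rw [real_inner_comm, negKHatSq, inner_neg_mul_self (hskew X), real_inner_self_eq_norm_sq,
    ← b.sum_sq_norm_inner_left]
  simp

theorem trace_negKHatSq_mul_self {ι : Type*} [Fintype ι] (b : OrthonormalBasis ι ℝ z)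
    (hskew : ∀ (X : z × v) A B, inner ℝ (kHat X A) B = -inner ℝ A (kHat X B)) (X : z × v) :
    LinearMap.trace ℝ z (negKHatSq X * negKHatSq X) =
      ∑ i, ∑ j, (∑ k, inner ℝ (kHat X (b i)) (b k) * inner ℝ (kHat X (b j)) (b k)) ^ 2 := by
  rw [LinearMap.trace_eq_sum_inner _ b]
  refine Finset.sum_congr rfl fun i _ => ?_
  rw [Module.End.mul_apply, real_inner_comm,
    show inner ℝ (negKHatSq X (negKHatSq X (b i))) (b i) =
      inner ℝ (negKHatSq X (b i)) (negKHatSq X (b i)) from isSymmetric_neg_mul_self (hskew X) _ _,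
    real_inner_self_eq_norm_sq, ← b.sum_sq_norm_inner_left]
  refine Finset.sum_congr rfl fun j _ => ?_
  rw [negKHatSq, inner_neg_mul_self (hskew X), ← b.sum_inner_mul_inner]
  simp [real_inner_comm]

theorem analyticAt_inner_kHat (A B : z) (X : z × v) :
    AnalyticAt ℝ (fun X : z × v => (inner ℝ (kHat X A) B : ℝ)) X := by
  simp_rw [inner_kHat]
  have h1 : AnalyticAt ℝ (fun X : z × v => cliffMul A (cliffMul X.1 X.2)) X :=
    ((cliffMul A : v →ₗ[ℝ] v).toContinuousLinearMap.analyticAt _).comp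
      ((cliffMul : z →ₗ[ℝ] v →ₗ[ℝ] v).toContinuousBilinearMap.analyticAt_bilinear X)
  have h2 : AnalyticAt ℝ (fun X : z × v => cliffMul B X.2) X :=
    ((cliffMul B : v →ₗ[ℝ] v).toContinuousLinearMap.analyticAt _).comp analyticAt_snd
  exact ((innerSL ℝ : v →L[ℝ] v →L[ℝ] ℝ).analyticAt_bilinear _).comp (h1.prod h2)

omit [FiniteDimensional ℝ z] [FiniteDimensional ℝ v] [Module (Cl z) v]
  [IsScalarTower ℝ (Cl z) v] in
theorem analyticAt_nHat (X : z × v) : AnalyticAt ℝ nHat X := by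
  have h1 : AnalyticAt ℝ (fun X : z × v => (inner ℝ X.1 X.1 : ℝ)) X :=
    ((innerSL ℝ : z →L[ℝ] z →L[ℝ] ℝ).analyticAt_bilinear _).comp
      (analyticAt_fst.prod analyticAt_fst)
  have h2 : AnalyticAt ℝ (fun X : z × v => (inner ℝ X.2 X.2 : ℝ)) X :=
    ((innerSL ℝ : v →L[ℝ] v →L[ℝ] ℝ).analyticAt_bilinear _).comp
      (analyticAt_snd.prod analyticAt_snd)
  exact h1.mul (h2.pow 2)

variable [IsOrthogonalCliffordModule z v]

omit [FiniteDimensional ℝ z] [FiniteDimensional ℝ v] in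
theorem inner_cliffMul_self (Z : z) (S : v) : inner ℝ (cliffMul Z S) S = (0 : ℝ) := by
  have := IsOrthogonalCliffordModule.inner_cliffMul_left Z S S
  rw [real_inner_comm] at this
  rw [real_inner_comm]
  linarith

/-- By polarization it suffices that `⟪kHat X Z, Z⟫ = 0`. Moving one factor `Z` across reduces this
to a multiple of `⟪X.1 • X.2, X.2⟫`, which is zero. -/
theorem kHat_skew (X : z × v) (A B : z) :
    inner ℝ (kHat X A) B = -(inner ℝ A (kHat X B) : ℝ) := by
  have key : ∀ Z, inner ℝ (kHat X Z) Z = (0 : ℝ) := by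
    intro Z
    rw [inner_kHat, IsOrthogonalCliffordModule.inner_cliffMul_left, cliffMul_cliffMul,
      inner_neg_right, real_inner_smul_right, inner_cliffMul_self]
    simp
  have h := key (A + B)
  rw [map_add, inner_add_left, inner_add_right, inner_add_right, key, key] at h
  rw [real_inner_comm]
  rw [real_inner_comm] at h
  linarith [real_inner_comm A (kHat X B), real_inner_comm B (kHat X A)]

theorem kHat_self (X : z × v) : kHat X X.1 = 0 := by
  refine ext_inner_right ℝ fun B => ?_
  rw [inner_kHat, cliffMul_cliffMul, inner_neg_left, real_inner_smul_left, real_inner_comm,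
    inner_cliffMul_self]
  simp

/-- Individual eigenvalues need not be analytic where they cross; their symmetric functions are
polynomial in the matrix entries of `kHat`, and so analytic everywhere. -/
theorem analyticAt_pHat (X : z × v) : AnalyticAt ℝ pHat X := by
  have : (pHat : z × v → ℝ) = fun X => (∑ i, ∑ j,
      inner ℝ (kHat X (stdOrthonormalBasis ℝ z i)) (stdOrthonormalBasis ℝ z j) ^ 2) / 2 := by
    funext X
    rw [pHat, trace_negKHatSq (stdOrthonormalBasis ℝ z) kHat_skew]
  rw [this]
  refine AnalyticAt.div_const ?_
  refine Finset.analyticAt_fun_sum _ fun i _ => Finset.analyticAt_fun_sum _ fun j _ => ?_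
  exact (analyticAt_inner_kHat _ _ X).pow 2

theorem analyticAt_qHat (X : z × v) : AnalyticAt ℝ qHat X := by
  have : (qHat : z × v → ℝ) = fun X => (pHat X ^ 2 - (∑ i, ∑ j,
      (∑ k, inner ℝ (kHat X (stdOrthonormalBasis ℝ z i)) (stdOrthonormalBasis ℝ z k) *
        inner ℝ (kHat X (stdOrthonormalBasis ℝ z j)) (stdOrthonormalBasis ℝ z k)) ^ 2) / 2) / 2 := by
    funext X
    rw [qHat, trace_negKHatSq_mul_self (stdOrthonormalBasis ℝ z) kHat_skew]
  rw [this]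
  refine AnalyticAt.div_const (((analyticAt_pHat X).pow 2).sub (AnalyticAt.div_const ?_))
  refine Finset.analyticAt_fun_sum _ fun i _ => Finset.analyticAt_fun_sum _ fun j _ =>
    AnalyticAt.pow (Finset.analyticAt_fun_sum _ fun k _ => ?_) 2
  exact (analyticAt_inner_kHat _ _ X).mul (analyticAt_inner_kHat _ _ X)

omit [IsOrthogonalCliffordModule z v] in
theorem negKCheckSq_eq (X : z × v) : negKCheckSq X = (nHat X)⁻¹ • negKHatSq X := by
  have h : (nHat X)⁻¹ = (‖X.1‖ * ‖X.2‖ ^ 2)⁻¹ * (‖X.1‖ * ‖X.2‖ ^ 2)⁻¹ := by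
    rw [nHat_eq, ← mul_inv]
    ring_nf
  rw [negKCheckSq, negKHatSq, kCheck, h, smul_neg, mul_smul, smul_mul_smul_comm, mul_smul]

/-- The eigenvalues of `-Ǩ(X)²`: zero and two further values `s`, `t`, with the multiplicities of
the nonzero ones. -/
theorem exists_spectrum (hn : finrank ℝ z ≤ 6) {X : z × v} (hX₁ : X.1 ≠ 0) :
    ∃ s t : ℝ, 0 ≤ s ∧ 0 ≤ t ∧ (finrank ℝ z ≤ 4 → t = 0) ∧
      s + t = pHat X / nHat X ∧ s * t = qHat X / nHat X ^ 2 ∧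
      (∀ r, (negKCheckSq X).HasEigenvalue r ↔ r = 0 ∨ r = s ∨ r = t) ∧
      ∀ r, r ≠ 0 → finrank ℝ ((negKCheckSq X).eigenspace r) =
        (if r = s then 2 else 0) + (if r = t then 2 else 0) := by
  have hskew : ∀ A B : z, inner ℝ (kCheck X A) B = -(inner ℝ A (kCheck X B) : ℝ) := by
    intro A B
    simp only [kCheck, LinearMap.smul_apply, real_inner_smul_left, real_inner_smul_right,
      kHat_skew X A B]
    ring
  have hker : kCheck X X.1 = 0 := by simp [kCheck, kHat_self]
  obtain ⟨s, t, hs, ht, h4, htr, htr2, hfin⟩ := exists_double_spectrum hskew hX₁ hker hn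
  have htr' : 2 * (s + t) = (nHat X)⁻¹ * (2 * pHat X) := by
    rw [← htr, pHat, ← negKCheckSq, negKCheckSq_eq, map_smul, smul_eq_mul]
    ring
  have htr2' : 2 * (s ^ 2 + t ^ 2) = (nHat X)⁻¹ ^ 2 * (2 * pHat X ^ 2 - 4 * qHat X) := by
    rw [← htr2, qHat, ← negKCheckSq, negKCheckSq_eq, smul_mul_smul_comm, map_smul, smul_eq_mul]
    ring
  have hst : s + t = pHat X / nHat X := by
    rw [div_eq_mul_inv]
    linarith
  refine ⟨s, t, hs, ht, h4, hst, ?_, ?_, hfin⟩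
  · have h1 : 2 * (s * t) = (s + t) ^ 2 - (s ^ 2 + t ^ 2) := by ring
    rw [hst] at h1
    have h2 : qHat X / nHat X ^ 2 = (nHat X)⁻¹ ^ 2 * qHat X := by
      rw [inv_pow, div_eq_mul_inv, mul_comm]
    have h3 : (pHat X / nHat X) ^ 2 = (nHat X)⁻¹ ^ 2 * pHat X ^ 2 := by
      rw [div_pow, inv_pow, div_eq_mul_inv, mul_comm]
    rw [h2]
    rw [h3] at h1
    linarith
  · intro r
    by_cases hr : r = 0
    · subst hr
      simp only [true_or, iff_true]
      refine End.hasEigenvalue_of_hasEigenvector (x := X.1) ⟨?_, hX₁⟩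
      rw [End.mem_eigenspace_iff]
      simp [negKCheckSq, hker]
    · have h := hfin r hr
      rw [← negKCheckSq] at h
      constructor
      · intro hev
        have hne : finrank ℝ ((negKCheckSq X).eigenspace r) ≠ 0 := fun h0 =>
          hev (Submodule.finrank_eq_zero.1 h0)
        by_contra hcon
        push Not at hcon
        rw [h, if_neg hcon.2.1, if_neg hcon.2.2] at hne
        exact hne rfl
      · intro hev hbot
        have : finrank ℝ ((negKCheckSq X).eigenspace r) = 0 := by
          rw [Submodule.finrank_eq_zero]; exact hbot
        rw [h] at this
        rcases hev with h0 | h0 | h0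
        · exact hr h0
        · rw [if_pos h0] at this; omega
        · rw [if_pos h0] at this; omega

end KOperators

/-! ### Eigenvalue branches -/

section Branches

open Module

variable {z v : Type*} [NormedAddCommGroup z] [InnerProductSpace ℝ z] [FiniteDimensional ℝ z]
  [NormedAddCommGroup v] [InnerProductSpace ℝ v] [FiniteDimensional ℝ v]
  [Module (Cl z) v] [IsScalarTower ℝ (Cl z) v]

theorem frequently_ne_zero_of_analytic {E : Type*} [NormedAddCommGroup E] [NormedSpace ℝ E]
    {f : E → ℝ} (hf : ∀ x, AnalyticAt ℝ f x) {x₀ : E} (h₀ : f x₀ ≠ 0) (x : E) :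
    ∃ᶠ y in 𝓝 x, f y ≠ 0 := by
  intro h
  have h' : ∀ᶠ y in 𝓝 x, f y = 0 := by simpa using h
  exact h₀ (AnalyticOnNhd.eqOn_zero_of_preconnected_of_eventuallyEq_zero (U := Set.univ)
    (fun y _ => hf y) isPreconnected_univ (Set.mem_univ x) h' (Set.mem_univ x₀))

theorem isOpen_regularSet : IsOpen (regularSet z v) := by
  rw [isOpen_iff_mem_nhds]
  rintro X ⟨h1, h2, h3⟩
  have h1' : ∀ᶠ Y : z × v in 𝓝 X, Y.1 ≠ 0 :=
    continuous_fst.continuousAt.eventually_ne h1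
  have h2' : ∀ᶠ Y : z × v in 𝓝 X, Y.2 ≠ 0 :=
    continuous_snd.continuousAt.eventually_ne h2
  filter_upwards [h1', h2', h3, eventually_eventually_nhds.2 h3] with Y hY1 hY2 hY3 hY4
  refine ⟨hY1, hY2, ?_⟩
  filter_upwards [hY4] with W hW
  rw [hW, hY3]

namespace IsRegularComponent

variable {U : Set (z × v)} (hU : IsRegularComponent U)
include hU

theorem isOpen : IsOpen U := by
  obtain ⟨X, hX, rfl⟩ := hU
  exact isOpen_regularSet.connectedComponentIn

theorem isPreconnected : IsPreconnected U := by
  obtain ⟨X, hX, rfl⟩ := hU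
  exact isPreconnected_connectedComponentIn

theorem nonempty : U.Nonempty := by
  obtain ⟨X, hX, rfl⟩ := hU
  exact ⟨X, mem_connectedComponentIn hX⟩

theorem subset : U ⊆ regularSet z v := by
  obtain ⟨X, hX, rfl⟩ := hU
  exact connectedComponentIn_subset _ _

/-- An analytic function that does not vanish identically is nonzero somewhere on `U`. -/
theorem exists_ne_zero {f : z × v → ℝ} (hf : ∀ X, AnalyticAt ℝ f X) {X₀ : z × v} (h₀ : f X₀ ≠ 0) :
    ∃ X ∈ U, f X ≠ 0 := by
  obtain ⟨X, hX⟩ := hU.nonempty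
  obtain ⟨Y, hY⟩ := ((frequently_ne_zero_of_analytic hf h₀ X).and_eventually
    (hU.isOpen.mem_nhds hX)).exists
  exact ⟨Y, hY.2, hY.1⟩

end IsRegularComponent

theorem IsEigenvalueBranch.continuous {U : Set (z × v)} {μ : U → ℝ} (h : IsEigenvalueBranch U μ) :
    Continuous μ := by
  obtain ⟨f, hf, hfμ⟩ := h.analytic
  have : μ = U.domRestrict f := funext fun X => (hfμ X).symm
  rw [this]
  exact hf.continuousOn.domRestrict

/-- A clopen argument. In the applications `h` takes its values among finitely many nowhere
coinciding continuous functions, so `{h ≠ f}` is the union of the closed sets where `h` equals one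
of the others. -/
theorem eq_or_forall_ne {T : Type*} [TopologicalSpace T] [PreconnectedSpace T] {h f : T → ℝ}
    (hh : Continuous h) (hf : Continuous f) (hc : IsClosed {x | h x ≠ f x}) :
    h = f ∨ ∀ x, h x ≠ f x := by
  have h1 : IsClosed {x | h x = f x} := isClosed_eq hh hf
  have h2 : IsClopen {x | h x = f x} := ⟨h1, by
    rw [← isClosed_compl_iff]
    exact hc⟩
  rcases isClopen_iff.1 h2 with h3 | h3
  · exact Or.inr fun x hx => (Set.eq_empty_iff_forall_notMem.1 h3 x) hx
  · exact Or.inl (funext fun x => (Set.eq_univ_iff_forall.1 h3 x))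

theorem nonzeroBranches_eq_singleton {U : Set (z × v)} (hU : IsPreconnected U) (hne : U.Nonempty)
    {f : U → ℝ} (hf : IsEigenvalueBranch U f)
    (hev : ∀ X : U, ∀ r, (negKCheckSq (X : z × v)).HasEigenvalue r → r = 0 ∨ r = f X)
    (hf0 : ∀ X, f X ≠ 0) : nonzeroBranches U = {f} := by
  have : PreconnectedSpace U := Subtype.preconnectedSpace hU
  ext h
  rw [Set.mem_singleton_iff]
  constructor
  · rintro ⟨hb, hb0⟩
    have hc : {x | h x ≠ f x} = {x | h x = 0} := by
      ext x
      rcases hev x _ (hb.hasEigenvalue x) with h1 | h1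
      · simp [h1, (hf0 x).symm]
      · simp [h1, hf0 x]
    rcases eq_or_forall_ne hb.continuous hf.continuous
      (hc ▸ isClosed_eq hb.continuous continuous_const) with h1 | h1
    · exact h1
    · exact absurd (funext fun x => (hev x _ (hb.hasEigenvalue x)).resolve_right (h1 x)) hb0
  · rintro rfl
    refine ⟨hf, fun h0 => ?_⟩
    obtain ⟨X, hX⟩ := hne
    exact hf0 ⟨X, hX⟩ (congrFun h0 _)

theorem nonzeroBranches_eq_pair {U : Set (z × v)} (hU : IsPreconnected U) (hne : U.Nonempty)
    {f g : U → ℝ} (hf : IsEigenvalueBranch U f) (hg : IsEigenvalueBranch U g)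
    (hev : ∀ X : U, ∀ r, (negKCheckSq (X : z × v)).HasEigenvalue r → r = 0 ∨ r = f X ∨ r = g X)
    (hf0 : ∀ X, f X ≠ 0) (hg0 : ∀ X, g X ≠ 0) (hfg : ∀ X, f X ≠ g X) :
    nonzeroBranches U = {f, g} := by
  have : PreconnectedSpace U := Subtype.preconnectedSpace hU
  ext h
  rw [Set.mem_insert_iff, Set.mem_singleton_iff]
  constructor
  · rintro ⟨hb, hb0⟩
    have hcf : {x | h x ≠ f x} = {x | h x = 0} ∪ {x | h x = g x} := by
      ext x
      rcases hev x _ (hb.hasEigenvalue x) with h1 | h1 | h1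
      · simp [h1, (hf0 x).symm]
      · simp [h1, hf0 x, hfg x]
      · simp [h1, (hfg x).symm]
    have hcg : {x | h x ≠ g x} = {x | h x = 0} ∪ {x | h x = f x} := by
      ext x
      rcases hev x _ (hb.hasEigenvalue x) with h1 | h1 | h1
      · simp [h1, (hg0 x).symm]
      · simp [h1, hfg x]
      · simp [h1, hg0 x, (hfg x).symm]
    have hc0 := isClosed_eq hb.continuous (continuous_const (y := (0 : ℝ)))
    rcases eq_or_forall_ne hb.continuous hf.continuous
      (hcf ▸ hc0.union (isClosed_eq hb.continuous hg.continuous)) with h1 | h1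
    · exact Or.inl h1
    · rcases eq_or_forall_ne hb.continuous hg.continuous
        (hcg ▸ hc0.union (isClosed_eq hb.continuous hf.continuous)) with h2 | h2
      · exact Or.inr h2
      · refine absurd (funext fun x => ?_) hb0
        exact ((hev x _ (hb.hasEigenvalue x)).resolve_right fun h3 => h3.elim (h1 x) (h2 x))
  · obtain ⟨X, hX⟩ := hne
    rintro (rfl | rfl)
    · exact ⟨hf, fun h0 => hf0 ⟨X, hX⟩ (congrFun h0 _)⟩
    · exact ⟨hg, fun h0 => hg0 ⟨X, hX⟩ (congrFun h0 _)⟩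

variable [IsOrthogonalCliffordModule z v]

/-- The expression on the right equals `nHat X ^ 4 * (s * t * (s - t) ^ 2)`, which is nonzero
exactly when `0`, `s`, `t` are distinct. -/
theorem numEigenvalues_eq_three_iff (hn : finrank ℝ z ≤ 6) {X : z × v} (hX₁ : X.1 ≠ 0)
    (hX₂ : X.2 ≠ 0) :
    numEigenvalues X = 3 ↔ qHat X * (pHat X ^ 2 - 4 * qHat X) ≠ 0 := by
  obtain ⟨s, t, hs, ht, -, hp, hq, hev, -⟩ := exists_spectrum hn hX₁
  have hN := (nHat_pos hX₁ hX₂).ne'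
  have hp' : pHat X = nHat X * (s + t) := by rw [hp]; field_simp
  have hq' : qHat X = nHat X ^ 2 * (s * t) := by rw [hq]; field_simp
  have hset : {r : ℝ | (negKCheckSq X).HasEigenvalue r} = {0, s, t} := by
    ext r
    simp [hev]
  have hprod : qHat X * (pHat X ^ 2 - 4 * qHat X) = nHat X ^ 4 * (s * t * (s - t) ^ 2) := by
    rw [hp', hq']; ring
  rw [hprod, numEigenvalues, hset]
  have hN4 : nHat X ^ 4 ≠ 0 := pow_ne_zero _ hN
  constructor
  · intro h
    have h2 : ∀ a b : ℝ, ({a, b} : Set ℝ).ncard ≤ 2 := fun a b =>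
      (Set.ncard_insert_le _ _).trans (by simp)
    have h3 : s ≠ 0 := by
      rintro rfl
      have := h2 0 t
      simp only [Set.insert_eq_of_mem (Set.mem_insert (0 : ℝ) {t})] at h
      omega
    have h4 : t ≠ 0 := by
      rintro rfl
      have := h2 s 0
      rw [Set.insert_eq_of_mem (show (0 : ℝ) ∈ ({s, 0} : Set ℝ) by simp)] at h
      omega
    have h5 : s ≠ t := by
      rintro rfl
      have := h2 0 s
      rw [Set.pair_eq_singleton] at h
      omega
    exact mul_ne_zero hN4 (mul_ne_zero (mul_ne_zero h3 h4) (pow_ne_zero _ (sub_ne_zero.2 h5)))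
  · intro h
    have h' := right_ne_zero_of_mul h
    have h5 : s ≠ t := fun h0 => right_ne_zero_of_mul h' (by simp [h0])
    have h3 := left_ne_zero_of_mul (left_ne_zero_of_mul h')
    have h4 := right_ne_zero_of_mul (left_ne_zero_of_mul h')
    exact Set.ncard_eq_three.2 ⟨0, s, t, h3.symm, h4.symm, h5, rfl⟩

/-- By the identity theorem every neighbourhood of a regular point contains points with three
eigenvalues. As the number is locally constant there, the regular point itself has three. -/
theorem disc_ne_zero_of_mem_regularSet (hn : finrank ℝ z ≤ 6) {X₀ : z × v}
    (h₀ : qHat X₀ * (pHat X₀ ^ 2 - 4 * qHat X₀) ≠ 0) {X : z × v} (hX : X ∈ regularSet z v) :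
    qHat X * (pHat X ^ 2 - 4 * qHat X) ≠ 0 := by
  obtain ⟨h1, h2, h3⟩ := hX
  have hana : ∀ Y : z × v, AnalyticAt ℝ
      (fun Y : z × v => qHat Y * (pHat Y ^ 2 - 4 * qHat Y)) Y := fun Y =>
    (analyticAt_qHat Y).mul (((analyticAt_pHat Y).pow 2).sub
      (analyticAt_const.mul (analyticAt_qHat Y)))
  have h1' : ∀ᶠ Y : z × v in 𝓝 X, Y.1 ≠ 0 :=
    continuous_fst.continuousAt.eventually_ne h1
  have h2' : ∀ᶠ Y : z × v in 𝓝 X, Y.2 ≠ 0 :=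
    continuous_snd.continuousAt.eventually_ne h2
  obtain ⟨Y, hY, hY1, hY2, hY3⟩ := ((frequently_ne_zero_of_analytic hana h₀ X).and_eventually
    (h1'.and (h2'.and h3))).exists
  rw [← numEigenvalues_eq_three_iff hn h1 h2, ← hY3]
  exact (numEigenvalues_eq_three_iff hn hY1 hY2).2 hY

theorem numEigenvalues_eq_two_iff (hn : finrank ℝ z ≤ 4) {X : z × v} (hX₁ : X.1 ≠ 0)
    (hX₂ : X.2 ≠ 0) : numEigenvalues X = 2 ↔ pHat X ≠ 0 := by
  obtain ⟨s, t, hs, ht, h4, hp, hq, hev, -⟩ := exists_spectrum (hn.trans (by norm_num)) hX₁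
  obtain rfl := h4 hn
  have hN := (nHat_pos hX₁ hX₂).ne'
  have hp' : pHat X = nHat X * s := by rw [← add_zero s, hp]; field_simp
  have hset : {r : ℝ | (negKCheckSq X).HasEigenvalue r} = {0, s} := by
    ext r
    simp only [hev, Set.mem_ofPred_eq, Set.mem_insert_iff, Set.mem_singleton_iff]
    tauto
  rw [hp', numEigenvalues, hset]
  constructor
  · intro h
    refine mul_ne_zero hN ?_
    rintro rfl
    simp at h
  · intro h
    exact Set.ncard_pair (right_ne_zero_of_mul h).symm

theorem pHat_ne_zero_of_mem_regularSet (hn : finrank ℝ z ≤ 4) {X₀ : z × v}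
    (h₀ : pHat X₀ ≠ 0) {X : z × v} (hX : X ∈ regularSet z v) : pHat X ≠ 0 := by
  obtain ⟨h1, h2, h3⟩ := hX
  have h1' : ∀ᶠ Y : z × v in 𝓝 X, Y.1 ≠ 0 :=
    continuous_fst.continuousAt.eventually_ne h1
  have h2' : ∀ᶠ Y : z × v in 𝓝 X, Y.2 ≠ 0 :=
    continuous_snd.continuousAt.eventually_ne h2
  obtain ⟨Y, hY, hY1, hY2, hY3⟩ :=
    ((frequently_ne_zero_of_analytic analyticAt_pHat h₀ X).and_eventually
      (h1'.and (h2'.and h3))).exists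
  rw [← numEigenvalues_eq_two_iff hn h1 h2, ← hY3]
  exact (numEigenvalues_eq_two_iff hn hY1 hY2).2 hY

/-- Every eigenvalue branch is a root of the reduced characteristic polynomial. -/
theorem root_of_hasEigenvalue (hn : finrank ℝ z ≤ 6) {X : z × v} (hX₁ : X.1 ≠ 0)
    (hX₂ : X.2 ≠ 0) {c : ℝ} (hc : c ≠ 0) (h : (negKCheckSq X).HasEigenvalue c) :
    c ^ 2 * nHat X ^ 2 - c * (pHat X * nHat X) + qHat X = 0 := by
  obtain ⟨s, t, -, -, -, hp, hq, hev, -⟩ := exists_spectrum hn hX₁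
  have hN := (nHat_pos hX₁ hX₂).ne'
  have hp' : pHat X = nHat X * (s + t) := by rw [hp]; field_simp
  have hq' : qHat X = nHat X ^ 2 * (s * t) := by rw [hq]; field_simp
  rw [hp', hq']
  rcases (hev c).1 h with rfl | rfl | rfl
  · exact absurd rfl hc
  · ring
  · ring

theorem hasEigenvalue_of_root (hn : finrank ℝ z ≤ 6) {X : z × v} (hX₁ : X.1 ≠ 0) {c : ℝ}
    (h : c ^ 2 - c * (pHat X / nHat X) + qHat X / nHat X ^ 2 = 0) :
    (negKCheckSq X).HasEigenvalue c := by
  obtain ⟨s, t, -, -, -, hp, hq, hev, -⟩ := exists_spectrum hn hX₁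
  rw [← hp, ← hq] at h
  have h' : (c - s) * (c - t) = 0 := by linear_combination h
  rw [hev]
  rcases mul_eq_zero.1 h' with h1 | h1
  · exact Or.inr (Or.inl (sub_eq_zero.1 h1))
  · exact Or.inr (Or.inr (sub_eq_zero.1 h1))

/-- Two distinct nonzero eigenvalues exhaust the nonzero spectrum and have multiplicity two. -/
theorem spectrum_of_two (hn : finrank ℝ z ≤ 6) {X : z × v} (hX₁ : X.1 ≠ 0) {a b : ℝ}
    (ha : (negKCheckSq X).HasEigenvalue a) (hb : (negKCheckSq X).HasEigenvalue b)
    (ha0 : a ≠ 0) (hb0 : b ≠ 0) (hab : a ≠ b) :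
    a + b = pHat X / nHat X ∧ a * b = qHat X / nHat X ^ 2 ∧
      (∀ r, (negKCheckSq X).HasEigenvalue r → r = 0 ∨ r = a ∨ r = b) ∧
      finrank ℝ ((negKCheckSq X).eigenspace a) = 2 ∧
      finrank ℝ ((negKCheckSq X).eigenspace b) = 2 := by
  obtain ⟨s, t, -, -, -, hp, hq, hev, hfin⟩ := exists_spectrum hn hX₁
  rw [hfin a ha0, hfin b hb0]
  rcases (hev a).1 ha with h1 | rfl | rfl
  · exact absurd h1 ha0
  · rcases (hev b).1 hb with h2 | h2 | rfl
    · exact absurd h2 hb0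
    · exact absurd h2.symm hab
    · exact ⟨hp, hq, fun r hr => (hev r).1 hr, by simp [hab], by simp [hab.symm]⟩
  · rcases (hev b).1 hb with h2 | rfl | h2
    · exact absurd h2 hb0
    · exact ⟨by rw [← hp]; ring, by rw [← hq]; ring,
        fun r hr => by have := (hev r).1 hr; tauto, by simp [hab], by simp [hab.symm]⟩
    · exact absurd h2.symm hab

theorem pair_of_branches (hn : finrank ℝ z ≤ 6) {U : Set (z × v)} (hU : IsRegularComponent U)
    {f g : U → ℝ} (hf : IsEigenvalueBranch U f) (hg : IsEigenvalueBranch U g)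
    (hf0 : ∀ X, f X ≠ 0) (hg0 : ∀ X, g X ≠ 0) (hfg : ∀ X, f X ≠ g X) :
    nonzeroBranches U = {f, g} ∧ HasMultiplicity U f 2 ∧ HasMultiplicity U g 2 := by
  have key := fun X : U => spectrum_of_two hn (hU.subset X.2).1 (hf.hasEigenvalue X)
    (hg.hasEigenvalue X) (hf0 X) (hg0 X) (hfg X)
  exact ⟨nonzeroBranches_eq_pair hU.isPreconnected hU.nonempty hf hg (fun X => (key X).2.2.1)
    hf0 hg0 hfg, fun X => (key X).2.2.2.1, fun X => (key X).2.2.2.2⟩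

/-- If the branch were a constant `c`, the analytic function `c ^ 2 * N ^ 2 - c * p * N + q` would
vanish on the open set `U`, hence everywhere. A single point per `c` rules this out. -/
theorem isNonconstant_of_root (hn : finrank ℝ z ≤ 6) {U : Set (z × v)}
    (hU : IsRegularComponent U) {μ : U → ℝ} (hμ : IsEigenvalueBranch U μ) (hμ0 : ∀ X, μ X ≠ 0)
    (hc : ∀ c : ℝ, c ≠ 0 →
      ∃ X : z × v, c ^ 2 * nHat X ^ 2 - c * (pHat X * nHat X) + qHat X ≠ 0) :
    IsNonconstant U μ := by
  rintro ⟨c, hcμ⟩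
  obtain ⟨X₁, hX₁⟩ := hU.nonempty
  have hc0 : c ≠ 0 := hcμ ⟨X₁, hX₁⟩ ▸ hμ0 _
  obtain ⟨X₀, hX₀⟩ := hc c hc0
  obtain ⟨X, hX, hne⟩ := hU.exists_ne_zero
    (f := fun X : z × v => c ^ 2 * nHat X ^ 2 - c * (pHat X * nHat X) + qHat X)
    (fun X => ((analyticAt_const.mul ((analyticAt_nHat X).pow 2)).sub
      (analyticAt_const.mul ((analyticAt_pHat X).mul (analyticAt_nHat X)))).add
      (analyticAt_qHat X)) hX₀
  refine hne (root_of_hasEigenvalue hn (hU.subset hX).1 (hU.subset hX).2.1 hc0 ?_)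
  rw [← hcμ ⟨X, hX⟩]
  exact hμ.hasEigenvalue ⟨X, hX⟩

/-- The branches are the two roots from the quadratic formula, with sign `ε = 1` or `ε = -1`. The
discriminant is `(s - t) ^ 2`, positive on `U`, so its square root is analytic there. -/
theorem exists_two_branches (hn : finrank ℝ z ≤ 6) {X₀ : z × v}
    (h₀ : qHat X₀ * (pHat X₀ ^ 2 - 4 * qHat X₀) ≠ 0)
    (hc : ∀ c : ℝ, c ≠ 0 →
      ∃ X : z × v, c ^ 2 * nHat X ^ 2 - c * (pHat X * nHat X) + qHat X ≠ 0)
    {U : Set (z × v)} (hU : IsRegularComponent U) :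
    ∃ μ₁ μ₂ : U → ℝ, μ₁ ≠ μ₂ ∧ nonzeroBranches U = {μ₁, μ₂} ∧
      IsNonconstant U μ₁ ∧ IsNonconstant U μ₂ ∧
      HasMultiplicity U μ₁ 2 ∧ HasMultiplicity U μ₂ 2 := by
  set p : z × v → ℝ := fun X => pHat X / nHat X with hpdef
  set q : z × v → ℝ := fun X => qHat X / nHat X ^ 2 with hqdef
  set f : ℝ → z × v → ℝ := fun ε X => (p X + ε * Real.sqrt (p X ^ 2 - 4 * q X)) / 2 with hfdef
  have hfacts : ∀ X ∈ U, 0 < nHat X ∧ 0 < p X ^ 2 - 4 * q X ∧ q X ≠ 0 := by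
    intro X hX
    have hreg := hU.subset hX
    have hN := nHat_pos hreg.1 hreg.2.1
    have hdisc := disc_ne_zero_of_mem_regularSet hn h₀ hreg
    obtain ⟨s, t, -, -, -, hp, hq, -, -⟩ := exists_spectrum hn hreg.1
    have h1 : p X ^ 2 - 4 * q X = (s - t) ^ 2 := by
      simp only [hpdef, hqdef]
      rw [← hp, ← hq]
      ring
    have h2 : p X ^ 2 - 4 * q X ≠ 0 := by
      have : p X ^ 2 - 4 * q X = (pHat X ^ 2 - 4 * qHat X) / nHat X ^ 2 := by
        simp only [hpdef, hqdef]
        field_simp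
      rw [this]
      exact div_ne_zero (right_ne_zero_of_mul hdisc) (pow_ne_zero _ hN.ne')
    refine ⟨hN, lt_of_le_of_ne (by rw [h1]; positivity) h2.symm, ?_⟩
    exact div_ne_zero (left_ne_zero_of_mul hdisc) (pow_ne_zero _ hN.ne')
  have hbranch : ∀ ε : ℝ, ε ^ 2 = 1 → IsEigenvalueBranch U (fun X => f ε X) := by
    intro ε hε
    refine ⟨fun X => ?_, f ε, fun X hX => ?_, fun X => rfl⟩
    · have hreg := hU.subset X.2
      refine hasEigenvalue_of_root hn hreg.1 ?_
      have hsq := Real.sq_sqrt (hfacts X X.2).2.1.le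
      change f ε X ^ 2 - f ε X * p X + q X = 0
      simp only [hfdef]
      linear_combination (ε ^ 2 / 4) * hsq + (p X ^ 2 - 4 * q X) / 4 * hε
    · obtain ⟨hN, hD, -⟩ := hfacts X hX
      have hp : AnalyticAt ℝ p X := (analyticAt_pHat X).div (analyticAt_nHat X) hN.ne'
      have hq : AnalyticAt ℝ q X := (analyticAt_qHat X).div ((analyticAt_nHat X).pow 2)
        (pow_ne_zero _ hN.ne')
      have hD' : AnalyticAt ℝ (fun X => p X ^ 2 - 4 * q X) X :=
        (hp.pow 2).sub (analyticAt_const.mul hq)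
      have hs : AnalyticAt ℝ (fun X => Real.sqrt (p X ^ 2 - 4 * q X)) X :=
        AnalyticAt.comp (g := Real.sqrt) (Real.contDiffAt_sqrt hD.ne').analyticAt hD'
      exact (hp.add (analyticAt_const.mul hs)).div_const
  have hnonzero : ∀ ε : ℝ, ε ^ 2 = 1 → ∀ X : U, f ε X ≠ 0 := by
    intro ε hε X h
    have hsq := Real.sq_sqrt (hfacts X X.2).2.1.le
    have h1 : f ε X ^ 2 - f ε X * p X + q X = 0 := by
      simp only [hfdef]
      linear_combination (ε ^ 2 / 4) * hsq + (p X ^ 2 - 4 * q X) / 4 * hε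
    rw [h] at h1
    exact (hfacts X X.2).2.2 (by linarith)
  have hne : ∀ X : U, f 1 X ≠ f (-1) X := by
    intro X h
    have := Real.sqrt_pos.2 (hfacts X X.2).2.1
    simp only [hfdef] at h
    linarith
  have h1 : (1 : ℝ) ^ 2 = 1 := by norm_num
  have h2 : (-1 : ℝ) ^ 2 = 1 := by norm_num
  obtain ⟨hpair, hm1, hm2⟩ := pair_of_branches hn hU (hbranch 1 h1) (hbranch (-1) h2)
    (hnonzero 1 h1) (hnonzero (-1) h2) hne
  refine ⟨_, _, ?_, hpair, isNonconstant_of_root hn hU (hbranch 1 h1) (hnonzero 1 h1) hc,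
    isNonconstant_of_root hn hU (hbranch (-1) h2) (hnonzero (-1) h2) hc, hm1, hm2⟩
  obtain ⟨X, hX⟩ := hU.nonempty
  exact fun h => hne ⟨X, hX⟩ (congrFun h _)

end Branches

/-! ### The operators in octonionic coordinates -/

section OctonionCoordinates

open Module

variable {z v : Type*} [NormedAddCommGroup z] [InnerProductSpace ℝ z] [FiniteDimensional ℝ z]
  [NormedAddCommGroup v] [InnerProductSpace ℝ v] [FiniteDimensional ℝ v]
  [Module (Cl z) v] [IsScalarTower ℝ (Cl z) v]

/-- `θ` is an isometric embedding of the octonions that carries right multiplication by `φ(Z)` to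
Clifford multiplication by `Z`. -/
structure IsOctonionCopy (φ : z →ₗᵢ[ℝ] Octonion) (θ : Octonion →ₗᵢ[ℝ] v) : Prop where
  isIm : ∀ Z : z, IsImOctonion (φ Z)
  cliffMul_map : ∀ (Z : z) (x : Octonion), cliffMul Z (θ x) = θ (octMul x (φ Z))

omit [FiniteDimensional ℝ z] [FiniteDimensional ℝ v] in
theorem IsOctonionModel.isOctonionCopy {φ : z →ₗᵢ[ℝ] Octonion} {ψ : v ≃ₗᵢ[ℝ] Octonion}
    (h : IsOctonionModel φ ψ) : IsOctonionCopy φ ψ.symm.toLinearIsometry where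
  isIm := h.isIm
  cliffMul_map Z x := by
    apply ψ.injective
    simp [h.map_cliffMul]

namespace IsOctonionCopy

variable {φ : z →ₗᵢ[ℝ] Octonion} {θ : Octonion →ₗᵢ[ℝ] v} (h : IsOctonionCopy φ θ)

include h

theorem inner_kHat (Y : z) (x : Octonion) (A B : z) :
    inner ℝ (kHat (Y, θ x) A) B = octForm x (φ Y) (φ A) (φ B) := by
  rw [_root_.inner_kHat, h.cliffMul_map, h.cliffMul_map, h.cliffMul_map, θ.inner_map_map, octForm]

theorem inner_kHat_add {θ' : Octonion →ₗᵢ[ℝ] v} (h' : IsOctonionCopy φ θ')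
    (horth : ∀ x y, inner ℝ (θ x) (θ' y) = (0 : ℝ)) (Y : z) (x y : Octonion) (A B : z) :
    inner ℝ (kHat (Y, θ x + θ' y) A) B =
      octForm x (φ Y) (φ A) (φ B) + octForm y (φ Y) (φ A) (φ B) := by
  rw [_root_.inner_kHat]
  simp only [map_add, h.cliffMul_map, h'.cliffMul_map, inner_add_left, inner_add_right,
    θ.inner_map_map, θ'.inner_map_map, horth]
  have horth' : inner ℝ (θ' (octMul (octMul y (φ Y)) (φ A))) (θ (octMul x (φ B))) = (0 : ℝ) := by
    rw [real_inner_comm, horth]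
  rw [horth', octForm, octForm]
  ring

omit [FiniteDimensional ℝ z] [FiniteDimensional ℝ v] [Module (Cl z) v] [IsScalarTower ℝ (Cl z) v] h in
theorem nHat_map (Y : z) (x : Octonion) :
    nHat (Y, θ x) = inner ℝ (φ Y) (φ Y) * inner ℝ x x ^ 2 := by
  rw [nHat, φ.inner_map_map, θ.inner_map_map]

variable {κ : Type*} [Fintype κ] {E : κ → Octonion} (hE : IsComplementFrame φ E)
  (hcard : finrank ℝ z + Fintype.card κ = 7)

include hE hcard

omit [FiniteDimensional ℝ z] [FiniteDimensional ℝ v] h hcard [Fintype κ] in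
theorem orthonormal_frame {ι : Type*} [Fintype ι] (b : OrthonormalBasis ι ℝ z) :
    Orthonormal ℝ (Sum.elim (fun i => φ (b i)) E) := by
  classical
  have hb := orthonormal_iff_ite.1 b.orthonormal
  have hE1 := orthonormal_iff_ite.1 hE.1
  rw [orthonormal_iff_ite]
  rintro (i | i) (j | j)
  · simpa using hb i j
  · simpa [real_inner_comm] using (hE.2 j).2 (b i)
  · simpa using (hE.2 i).2 (b j)
  · simpa using hE1 i j

/-- The trace is the sum of the squared entries over `z`, and frame splitting moves this sum to the
complement. With `n + k = 7` the coefficient `n - 1 - k` is `0`, `2`, `4` for `n = 4`, `5`, `6`. -/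
theorem pHat_map [IsOrthogonalCliffordModule z v] (Y : z) (x : Octonion) :
    pHat (Y, θ x) = ((finrank ℝ z - 1 - Fintype.card κ) * nHat (Y, θ x) +
      ∑ i, ∑ j, octForm x (φ Y) (E i) (E j) ^ 2) / 2 := by
  set b := stdOrthonormalBasis ℝ z
  have h1 := sum_sum_octForm_sq (b := fun i => φ (b i)) (E := E) (by simpa using hcard)
    (orthonormal_frame hE b) (fun i => h.isIm _) (fun i => (hE.2 i).1) x (h.isIm Y)
    (by simp only [φ.inner_map_map]
        rw [real_inner_self_eq_norm_sq, ← b.sum_sq_norm_inner_left]; simp)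
    (fun i => by rw [real_inner_comm]; exact (hE.2 i).2 Y)
  rw [pHat, trace_negKHatSq b kHat_skew, nHat_map]
  simp only [h.inner_kHat]
  rw [h1, Fintype.card_fin]

/-- Parseval for a single row: what `kHat` lacks from norm `nHat * ⟪A, A⟫` is the part along `Y` and
the part leaking into the complement of `z`. This yields both the upper bound and its equality case.
-/
theorem inner_kHat_self (Y : z) (x : Octonion) (A : z) :
    inner ℝ (kHat (Y, θ x) A) (kHat (Y, θ x) A) +
      ∑ i, octForm x (φ Y) (φ A) (E i) ^ 2 =
      nHat (Y, θ x) * inner ℝ A A - inner ℝ x x ^ 2 * inner ℝ Y A ^ 2 := by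
  set b := stdOrthonormalBasis ℝ z
  have h1 := sum_octForm_sq (by simpa using hcard) (orthonormal_frame hE b)
    (by rintro (i | i)
        exacts [h.isIm _, (hE.2 i).1]) x (Y := φ Y) (h.isIm A)
  rw [Fintype.sum_sum_type] at h1
  simp only [Sum.elim_inl, Sum.elim_inr, φ.inner_map_map] at h1
  have h2 : inner ℝ (kHat (Y, θ x) A) (kHat (Y, θ x) A) =
      ∑ i, octForm x (φ Y) (φ A) (φ (b i)) ^ 2 := by
    simp_rw [← h.inner_kHat]
    rw [real_inner_self_eq_norm_sq, ← b.sum_sq_norm_inner_left]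
    simp
  rw [h2, h1, nHat_map, φ.inner_map_map]
  ring

theorem inner_kHat_self_le (X : z × v) (hX : ∃ x, θ x = X.2) (A : z) :
    inner ℝ (kHat X A) (kHat X A) ≤ nHat X * inner ℝ A A := by
  obtain ⟨x, hx⟩ := hX
  have h1 := h.inner_kHat_self hE hcard X.1 x A
  rw [hx] at h1
  have h2 : 0 ≤ ∑ i, octForm x (φ X.1) (φ A) (E i) ^ 2 := Finset.sum_nonneg fun i _ => sq_nonneg _
  have h3 : 0 ≤ (inner ℝ x x : ℝ) ^ 2 * inner ℝ X.1 A ^ 2 := by positivity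
  linarith

theorem hasEigenvalue_le_one [IsOrthogonalCliffordModule z v] {X : z × v} (hX₁ : X.1 ≠ 0)
    (hX₂ : X.2 ≠ 0) (hX : ∃ x, θ x = X.2) {r : ℝ} (hr : (negKCheckSq X).HasEigenvalue r) :
    r ≤ 1 := by
  obtain ⟨A, hA⟩ := hr.exists_hasEigenvector
  have hN := nHat_pos hX₁ hX₂
  have h1 := h.inner_kHat_self_le hE hcard X hX A
  have h2 := hA.apply_eq_smul
  rw [negKCheckSq_eq, LinearMap.smul_apply] at h2
  have h3 : inner ℝ (kHat X A) (kHat X A) = nHat X * (r * inner ℝ A A) := by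
    rw [← inner_neg_mul_self (kHat_skew X), ← negKHatSq, ← real_inner_smul_left, ← h2,
      real_inner_smul_left, mul_inv_cancel_left₀ hN.ne']
  have h4 : 0 < inner ℝ A A := real_inner_self_pos.2 hA.2
  rw [h3] at h1
  have h5 := le_of_mul_le_mul_left h1 hN
  by_contra hcon
  nlinarith

/-- If the complement of `φ(z)` is a plane, the normalizing factor is an eigenvalue of `-K̂²`. -/
theorem hasEigenvalue_nHat [IsOrthogonalCliffordModule z v] (hn : finrank ℝ z = 5) (X : z × v)
    (hX : ∃ x, θ x = X.2) : (negKHatSq X).HasEigenvalue (nHat X) := by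
  obtain ⟨x, hx⟩ := hX
  -- Equality in the norm bound is `1 + 2` linear conditions on a vector of the five-dimensional
  -- `z`, so a nonzero solution exists.
  let L : z →ₗ[ℝ] ℝ × (κ → ℝ) :=
    { toFun := fun Z => (inner ℝ X.1 Z, fun i => octForm x (φ X.1) (φ Z) (E i))
      map_add' := fun Z W => by
        ext <;> simp only [octForm, map_add, octMul_add, inner_add_left, inner_add_right] <;> rfl
      map_smul' := fun c Z => by
        ext <;> simp only [octForm, map_smul, octMul_smul, real_inner_smul_left,
          real_inner_smul_right] <;> rfl }
  have hker : LinearMap.ker L ≠ ⊥ := by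
    apply LinearMap.ker_ne_bot_of_finrank_lt
    rw [finrank_prod, finrank_self, finrank_fintype_fun_eq_card]
    omega
  obtain ⟨Z, hZ, hZ0⟩ := Submodule.exists_mem_ne_zero_of_ne_bot hker
  have hZ1 : inner ℝ X.1 Z = (0 : ℝ) := congrArg Prod.fst hZ
  have hZ2 : ∀ i, octForm x (φ X.1) (φ Z) (E i) = 0 := fun i =>
    congrFun (congrArg Prod.snd hZ) i
  have h1 := h.inner_kHat_self hE hcard X.1 x Z
  have h2 := h.inner_kHat_self_le hE hcard X ⟨x, hx⟩ (kHat X Z)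
  simp only [hx, hZ1, hZ2] at h1
  refine End.hasEigenvalue_of_hasEigenvector (x := Z) ⟨?_, hZ0⟩
  -- With `‖K Z‖² = N ‖Z‖²` and `‖K K Z‖² ≤ N ‖K Z‖²`, expanding `‖-K² Z - N Z‖²` gives at most `0`.
  rw [End.mem_eigenspace_iff, ← sub_eq_zero, ← inner_self_eq_zero (𝕜 := ℝ)]
  refine le_antisymm ?_ real_inner_self_nonneg
  have h3 : inner ℝ (negKHatSq X Z) Z = (inner ℝ (kHat X Z) (kHat X Z) : ℝ) :=
    inner_neg_mul_self (kHat_skew X) Z Z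
  have h4 : inner ℝ (negKHatSq X Z) (negKHatSq X Z) =
      (inner ℝ (kHat X (kHat X Z)) (kHat X (kHat X Z)) : ℝ) := by simp [negKHatSq]
  simp only [inner_sub_left, inner_sub_right, real_inner_smul_left, real_inner_smul_right,
    real_inner_comm (negKHatSq X Z) Z, h3, h4]
  simp at h1
  simp only [← real_inner_self_eq_norm_sq] at h1
  rw [h1] at h2 ⊢
  linarith

end IsOctonionCopy

end OctonionCoordinates

/-! ### Octonionic copies in Clifford modules -/

section Existence

open Module

variable {z v : Type*} [NormedAddCommGroup z] [InnerProductSpace ℝ z]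
  [NormedAddCommGroup v] [InnerProductSpace ℝ v] [Module (Cl z) v] [IsScalarTower ℝ (Cl z) v]

theorem smul_mem_of_cliffMul_mem {W : Submodule ℝ v}
    (hW : ∀ Z : z, ∀ x ∈ W, cliffMul Z x ∈ W) (c : Cl z) : ∀ x ∈ W, c • x ∈ W := by
  induction c using CliffordAlgebra.induction with
  | algebraMap r => exact fun x hx => by rw [algebraMap_smul]; exact W.smul_mem r hx
  | ι Z => exact fun x hx => hW Z x hx
  | mul a b ha hb => exact fun x hx => by rw [mul_smul]; exact ha _ (hb _ hx)
  | add a b ha hb => exact fun x hx => by rw [add_smul]; exact W.add_mem (ha _ hx) (hb _ hx)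

variable [IsOrthogonalCliffordModule z v]

theorem exists_isOctonionCopy {n : ℕ} (b : OrthonormalBasis (Fin n) ℝ z) (hn : n ≤ 7)
    (hn' : n = 4 ∨ n = 5 ∨ n = 6) {W : Submodule ℝ v} (hW : W ≠ ⊥)
    (hinv : ∀ Z : z, ∀ x ∈ W, cliffMul Z x ∈ W) :
    ∃ θ : Octonion →ₗᵢ[ℝ] v, (∀ x, θ x ∈ W) ∧ IsOctonionCopy (stdEmbedding b hn) θ := by
  obtain ⟨θ, h1, h2⟩ := exists_octonion_intertwiner b hn hn' hW hinv
  exact ⟨θ, h1, isImOctonion_stdEmbedding b hn, h2⟩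

/-- The image of an octonionic copy is a nonzero submodule, so by simplicity it is everything and
the embedding is invertible. -/
theorem exists_isOctonionModel {n : ℕ} (b : OrthonormalBasis (Fin n) ℝ z) (hn : n ≤ 7)
    (hn' : n = 4 ∨ n = 5 ∨ n = 6) (hv : IsSimpleModule (Cl z) v) :
    ∃ ψ : v ≃ₗᵢ[ℝ] Octonion, IsOctonionModel (stdEmbedding b hn) ψ := by
  have := IsSimpleModule.nontrivial (Cl z) v
  obtain ⟨θ, -, hθ⟩ := exists_isOctonionCopy (v := v) b hn hn' (W := ⊤) top_ne_bot
    (fun _ _ _ => Submodule.mem_top)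
  have hinv : ∀ Z : z, ∀ x ∈ LinearMap.range θ.toLinearMap,
      cliffMul Z x ∈ LinearMap.range θ.toLinearMap := by
    rintro Z _ ⟨x, rfl⟩
    exact ⟨_, (hθ.cliffMul_map Z x).symm⟩
  let R : Submodule (Cl z) v :=
    { LinearMap.range θ.toLinearMap with
      smul_mem' := fun c x hx => smul_mem_of_cliffMul_mem hinv c x hx }
  have hR : R = ⊤ := by
    refine (eq_bot_or_eq_top R).resolve_left fun hbot => ?_
    have h1 : θ octOne ∈ R := ⟨octOne, rfl⟩
    rw [hbot, Submodule.mem_bot] at h1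
    have h2 := inner_octOne_self
    rw [← θ.inner_map_map, h1, inner_zero_left] at h2
    exact zero_ne_one h2
  have hsurj : Function.Surjective θ := by
    intro x
    have : x ∈ R := hR ▸ Submodule.mem_top
    exact this
  let ψ := (LinearIsometryEquiv.ofSurjective θ hsurj).symm
  have hψ : ∀ x, ψ (θ x) = x := fun x =>
    (LinearIsometryEquiv.ofSurjective θ hsurj).symm_apply_apply x
  refine ⟨ψ, hθ.isIm, fun Z S => ?_⟩
  obtain ⟨x, rfl⟩ := hsurj S
  rw [hθ.cliffMul_map, hψ, hψ]

variable [FiniteDimensional ℝ v]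

theorem eight_le_finrank {n : ℕ} (b : OrthonormalBasis (Fin n) ℝ z) (hn : n ≤ 7)
    (hn' : n = 4 ∨ n = 5 ∨ n = 6) {W : Submodule ℝ v} (hW : W ≠ ⊥)
    (hinv : ∀ Z : z, ∀ x ∈ W, cliffMul Z x ∈ W) : 8 ≤ finrank ℝ W := by
  obtain ⟨θ, h1, -⟩ := exists_isOctonionCopy b hn hn' hW hinv
  rw [← finrank_octonion]
  exact LinearMap.finrank_le_finrank_of_injective (f := θ.toLinearMap.codRestrict W h1)
    fun x y hxy => θ.injective (congrArg Subtype.val hxy)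

/-- The given summands need not be orthogonal; they only show that the dimension is at least 16. The
second copy is found in the orthogonal complement of the first, which is nonzero for dimension
reasons and invariant because Clifford multiplication is skew. -/
theorem exists_two_isOctonionCopy {n : ℕ} (b : OrthonormalBasis (Fin n) ℝ z) (hn : n ≤ 7)
    (hn' : n = 4 ∨ n = 5 ∨ n = 6) (hv : IsSplitModule z v) :
    ∃ θ θ' : Octonion →ₗᵢ[ℝ] v, IsOctonionCopy (stdEmbedding b hn) θ ∧
      IsOctonionCopy (stdEmbedding b hn) θ' ∧ ∀ x y, inner ℝ (θ x) (θ' y) = (0 : ℝ) := by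
  obtain ⟨v₁, v₂, h1, h2, hc⟩ := hv
  have hinv : ∀ w : Submodule (Cl z) v, ∀ Z : z, ∀ x ∈ w.restrictScalars ℝ,
      cliffMul Z x ∈ w.restrictScalars ℝ := fun w Z x hx => w.smul_mem _ hx
  have h1' : v₁.restrictScalars ℝ ≠ ⊥ := by simpa using h1
  have h2' : v₂.restrictScalars ℝ ≠ ⊥ := by simpa using h2
  have hc' : (v₁.restrictScalars ℝ) ⊓ (v₂.restrictScalars ℝ) = ⊥ := by
    have := hc.inf_eq_bot
    ext x
    have hx : x ∈ v₁ ⊓ v₂ ↔ x ∈ (⊥ : Submodule (Cl z) v) := by rw [this]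
    simpa using hx
  have hdim : 16 ≤ finrank ℝ v := by
    have h8 := eight_le_finrank b hn hn' h1' (hinv v₁)
    have h8' := eight_le_finrank b hn hn' h2' (hinv v₂)
    have := Submodule.finrank_sup_add_finrank_inf_eq (v₁.restrictScalars ℝ) (v₂.restrictScalars ℝ)
    rw [hc', finrank_bot] at this
    have := Submodule.finrank_le (v₁.restrictScalars ℝ ⊔ v₂.restrictScalars ℝ)
    omega
  obtain ⟨θ, -, hθ⟩ := exists_isOctonionCopy b hn hn' h1' (hinv v₁)
  set R := LinearMap.range θ.toLinearMap
  have hR : finrank ℝ R = 8 := by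
    rw [LinearMap.finrank_range_of_inj θ.injective, finrank_octonion]
  have hRbot : Rᗮ ≠ ⊥ := by
    intro h0
    have := Submodule.finrank_add_finrank_orthogonal R
    rw [h0, finrank_bot] at this
    omega
  obtain ⟨θ', hθ'R, hθ'⟩ := exists_isOctonionCopy b hn hn' hRbot (fun Z x hx => by
    rw [Submodule.mem_orthogonal] at hx ⊢
    rintro _ ⟨y, rfl⟩
    have h3 := IsOrthogonalCliffordModule.inner_cliffMul_left Z (θ y) x
    have h4 : inner ℝ (θ (octMul y (stdEmbedding b hn Z))) x = (0 : ℝ) := hx _ ⟨_, rfl⟩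
    rw [hθ.cliffMul_map, h4] at h3
    exact neg_eq_zero.1 h3.symm)
  exact ⟨θ, θ', hθ, hθ', fun x y => (Submodule.mem_orthogonal _ _).1 (hθ'R y) _ ⟨x, rfl⟩⟩

end Existence

/-! ### Special points -/

section SpecialPoints

open Module

variable {z v : Type*} [NormedAddCommGroup z] [InnerProductSpace ℝ z]
  [NormedAddCommGroup v] [InnerProductSpace ℝ v] [FiniteDimensional ℝ v]
  [Module (Cl z) v] [IsScalarTower ℝ (Cl z) v]

theorem isComplementFrame_stdEmbedding {n : ℕ} (b : OrthonormalBasis (Fin n) ℝ z) (hn : n ≤ 7)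
    {κ : Type*} {g : κ → Fin 7} (hg : Function.Injective g) (hgn : ∀ i, n ≤ g i) :
    IsComplementFrame (stdEmbedding b hn) (imUnit ∘ g) :=
  ⟨orthonormal_imUnit.comp g hg, fun i =>
    ⟨isImOctonion_imUnit _, inner_imUnit_stdEmbedding b hn (hgn i)⟩⟩

theorem octForm_octOne_plane {Y : Octonion} (hY : IsImOctonion Y) :
    octForm octOne Y (imUnit 5) (imUnit 6) ^ 2 = Y.fst.imI ^ 2 := by
  simp only [IsImOctonion] at hY
  simp only [octForm, inner_octonion]
  simp [octOne, imUnit, hY]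

theorem octForm_octOne_triple {Y : Octonion} (hY : IsImOctonion Y) :
    octForm octOne Y (imUnit 4) (imUnit 5) ^ 2 = Y.fst.imK ^ 2 ∧
      octForm octOne Y (imUnit 6) (imUnit 4) ^ 2 = Y.fst.imJ ^ 2 := by
  simp only [IsImOctonion] at hY
  simp only [octForm, inner_octonion]
  simp [octOne, imUnit, hY]

/-- The form is quadratic in its first argument, so `2 • octOne` contributes with weight `4` and
`imUnit 3` with weight `1`. The contributions have opposite signs on one plane and equal signs on
the other, whence `3` and `5`. -/
theorem octForm_add_octForm_first {w : Octonion} (hw : IsImOctonion w) :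
    octForm ((2 : ℝ) • octOne) (imUnit 0) (imUnit 1) w +
        octForm (imUnit 3) (imUnit 0) (imUnit 1) w = 3 * inner ℝ (imUnit 2) w ∧
      octForm ((2 : ℝ) • octOne) (imUnit 0) (imUnit 2) w +
        octForm (imUnit 3) (imUnit 0) (imUnit 2) w = -3 * inner ℝ (imUnit 1) w ∧
      octForm ((2 : ℝ) • octOne) (imUnit 0) (imUnit 3) w +
        octForm (imUnit 3) (imUnit 0) (imUnit 3) w = 5 * inner ℝ (imUnit 4) w ∧
      octForm ((2 : ℝ) • octOne) (imUnit 0) (imUnit 4) w +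
        octForm (imUnit 3) (imUnit 0) (imUnit 4) w = -5 * inner ℝ (imUnit 3) w := by
  simp only [IsImOctonion] at hw
  simp only [octForm, inner_octonion]
  simp [octOne, imUnit, hw]
  refine ⟨?_, ?_, ?_, ?_⟩ <;> ring

/-- Away from the last unit the forms of `octOne` and `imUnit 5` cancel, which makes `kHat` vanish
at a point whose components are both nonzero. -/
theorem octForm_add_octForm_second {a w : Octonion} (ha : IsImOctonion a) (hw : IsImOctonion w)
    (ha6 : inner ℝ (imUnit 6) a = (0 : ℝ)) (hw6 : inner ℝ (imUnit 6) w = (0 : ℝ)) :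
    octForm octOne (imUnit 0) a w + octForm (imUnit 5) (imUnit 0) a w = 0 := by
  rw [inner_imUnit] at ha6 hw6
  simp at ha6 hw6
  simp only [IsImOctonion] at ha hw
  simp only [octForm, inner_octonion]
  simp [octOne, imUnit, ha, hw, ha6, hw6]
  ring

end SpecialPoints

/-! ### The eigenvalue branches in dimensions four, five and six -/

section Dimensions

open Module

variable {z v : Type*} [NormedAddCommGroup z] [InnerProductSpace ℝ z] [FiniteDimensional ℝ z]
  [NormedAddCommGroup v] [InnerProductSpace ℝ v] [FiniteDimensional ℝ v]
  [Module (Cl z) v] [IsScalarTower ℝ (Cl z) v]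

theorem kHat_eq_smul_of_inner {φ : z →ₗᵢ[ℝ] Octonion} {X : z × v} {A B : z} {c : ℝ}
    (h : ∀ W, inner ℝ (kHat X A) W = c * inner ℝ (φ B) (φ W)) : kHat X A = c • B := by
  refine ext_inner_right ℝ fun W => ?_
  rw [h, φ.inner_map_map, real_inner_smul_left]

/-- `kHat X` acts on the plane of `A` and `B` as `c` times a quarter turn. -/
theorem hasEigenvalue_of_rotation {X : z × v} {A B : z} {c : ℝ} (hA : kHat X A = c • B)
    (hB : kHat X B = (-c) • A) (hA0 : A ≠ 0) :
    (negKCheckSq X).HasEigenvalue (c ^ 2 / nHat X) := by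
  refine End.hasEigenvalue_of_hasEigenvector (x := A) ⟨?_, hA0⟩
  rw [End.mem_eigenspace_iff, negKCheckSq_eq]
  simp only [negKHatSq, LinearMap.smul_apply, LinearMap.neg_apply, Module.End.mul_apply, hA, hB,
    map_smul, smul_smul, ← neg_smul]
  congr 1
  ring

variable [IsOrthogonalCliffordModule z v]

/-- The two points used to separate the eigenvalues of a decomposable module. -/
theorem exists_separating_points {n : ℕ} (b : OrthonormalBasis (Fin n) ℝ z)
    (hn' : n = 5 ∨ n = 6) (hv : IsSplitModule z v) :
    (∃ X₀ : z × v, qHat X₀ * (pHat X₀ ^ 2 - 4 * qHat X₀) ≠ 0) ∧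
      ∃ X₁ : z × v, nHat X₁ ≠ 0 ∧ pHat X₁ = 0 ∧ qHat X₁ = 0 := by
  have hn : n ≤ 7 := by omega
  have hdim : finrank ℝ z = n := by simpa using finrank_eq_card_basis b.toBasis
  obtain ⟨θ, θ', hθ, hθ', horth⟩ := exists_two_isOctonionCopy b hn (by omega) hv
  have horth' : ∀ x y, inner ℝ (θ' y) (θ x) = (0 : ℝ) := fun x y => by
    rw [real_inner_comm, horth]
  let e : ∀ k : ℕ, k < 5 → z := fun k hk => b ⟨k, by omega⟩
  have he : ∀ k hk, stdEmbedding b hn (e k hk) = imUnit ⟨k, by omega⟩ := fun k hk =>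
    stdEmbedding_apply b hn _
  have he0 : ∀ k hk, e k hk ≠ 0 := fun k hk => b.orthonormal.ne_zero _
  have h0 := he 0 (by norm_num)
  have h1 := he 1 (by norm_num)
  have h2 := he 2 (by norm_num)
  have h3 := he 3 (by norm_num)
  have h4 := he 4 (by norm_num)
  have hw := fun W : z => octForm_add_octForm_first (hθ.isIm W)
  have hunit : ∀ i, inner ℝ (imUnit i) (imUnit i) = (1 : ℝ) := fun i => by
    rw [real_inner_self_eq_norm_sq, orthonormal_imUnit.1, one_pow]
  have hee : inner ℝ (e 0 (by norm_num)) (e 0 (by norm_num)) = (1 : ℝ) := by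
    rw [← (stdEmbedding b hn).inner_map_map, h0, hunit]
  constructor
  -- Here the rescaled eigenvalues are `9 / 25` and `1`, so `p = 9 + 25`, `q = 9 * 25` and the
  -- discriminant is nonzero.
  · set X₀ : z × v := (e 0 (by norm_num), θ ((2 : ℝ) • octOne) + θ' (imUnit 3)) with hX₀
    have hN : nHat X₀ = 25 := by
      simp only [nHat, hX₀, inner_add_left, inner_add_right, θ.inner_map_map, θ'.inner_map_map,
        horth, horth', real_inner_smul_left, real_inner_smul_right, inner_octOne_self, hunit, hee]
      norm_num
    have k1 : kHat X₀ (e 1 (by norm_num)) = (3 : ℝ) • e 2 (by norm_num) :=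
      kHat_eq_smul_of_inner (φ := stdEmbedding b hn) fun W => by
        rw [hX₀, hθ.inner_kHat_add hθ' horth, h0, h1, h2]
        exact (hw W).1
    have k2 : kHat X₀ (e 2 (by norm_num)) = (-3 : ℝ) • e 1 (by norm_num) :=
      kHat_eq_smul_of_inner (φ := stdEmbedding b hn) fun W => by
        rw [hX₀, hθ.inner_kHat_add hθ' horth, h0, h1, h2]
        exact (hw W).2.1
    have k3 : kHat X₀ (e 3 (by norm_num)) = (5 : ℝ) • e 4 (by norm_num) :=
      kHat_eq_smul_of_inner (φ := stdEmbedding b hn) fun W => by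
        rw [hX₀, hθ.inner_kHat_add hθ' horth, h0, h3, h4]
        exact (hw W).2.2.1
    have k4 : kHat X₀ (e 4 (by norm_num)) = (-5 : ℝ) • e 3 (by norm_num) :=
      kHat_eq_smul_of_inner (φ := stdEmbedding b hn) fun W => by
        rw [hX₀, hθ.inner_kHat_add hθ' horth, h0, h3, h4]
        exact (hw W).2.2.2
    have hev1 := hasEigenvalue_of_rotation k1 k2 (he0 1 (by norm_num))
    have hev2 := hasEigenvalue_of_rotation k3 k4 (he0 3 (by norm_num))
    rw [hN] at hev1 hev2
    obtain ⟨hp, hq, -⟩ := spectrum_of_two (by omega) (he0 0 (by norm_num)) hev1 hev2 (by norm_num)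
      (by norm_num) (by norm_num)
    rw [hN] at hp hq
    have hp' : pHat X₀ = 34 := by linarith
    have hq' : qHat X₀ = 225 := by linarith
    refine ⟨X₀, ?_⟩
    rw [hp', hq']
    norm_num
  -- At this point `kHat` is zero while `nHat` is not, so no constant `c ≠ 0` satisfies the
  -- quadratic equation.
  · set X₁ : z × v := (e 0 (by norm_num), θ octOne + θ' (imUnit 5)) with hX₁
    have hN : nHat X₁ = 4 := by
      simp only [nHat, hX₁, inner_add_left, inner_add_right, θ.inner_map_map, θ'.inner_map_map,
        horth, horth', inner_octOne_self, hunit, hee]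
      norm_num
    have hK : kHat X₁ = 0 := by
      ext A
      refine ext_inner_right ℝ fun W => ?_
      rw [hX₁, hθ.inner_kHat_add hθ' horth, h0, LinearMap.zero_apply, inner_zero_left]
      have h6 : n ≤ ((6 : Fin 7) : ℕ) := by
        change n ≤ 6
        omega
      exact octForm_add_octForm_second (hθ.isIm A) (hθ.isIm W)
        (inner_imUnit_stdEmbedding b hn h6 A) (inner_imUnit_stdEmbedding b hn h6 W)
    have hA : negKHatSq X₁ = 0 := by rw [negKHatSq, hK]; simp
    have hp : pHat X₁ = 0 := by rw [pHat, hA]; simp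
    refine ⟨X₁, by rw [hN]; norm_num, hp, ?_⟩
    rw [qHat, hp, hA]
    simp

theorem branches_of_split {n : ℕ} (b : OrthonormalBasis (Fin n) ℝ z) (hn' : n = 5 ∨ n = 6)
    (hv : IsSplitModule z v) {U : Set (z × v)} (hU : IsRegularComponent U) :
    ∃ μ₁ μ₂ : U → ℝ, μ₁ ≠ μ₂ ∧ nonzeroBranches U = {μ₁, μ₂} ∧
      IsNonconstant U μ₁ ∧ IsNonconstant U μ₂ ∧
      HasMultiplicity U μ₁ 2 ∧ HasMultiplicity U μ₂ 2 := by
  have hdim : finrank ℝ z = n := by simpa using finrank_eq_card_basis b.toBasis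
  obtain ⟨⟨X₀, h₀⟩, X₁, hN, hp, hq⟩ := exists_separating_points b hn' hv
  refine exists_two_branches (by omega) h₀ (fun c hc => ⟨X₁, ?_⟩) hU
  rw [hp, hq]
  simpa using ⟨hc, hN⟩

/-- In dimension four the function `p̂ / n̂` is the only nonzero branch. -/
theorem branches_of_four [Nontrivial v] (b : OrthonormalBasis (Fin 4) ℝ z) {U : Set (z × v)}
    (hU : IsRegularComponent U) :
    nonzeroBranches U = {fun X : U => pHat (X : z × v) / nHat (X : z × v)} ∧
      IsNonconstant U (fun X : U => pHat (X : z × v) / nHat (X : z × v)) ∧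
      HasMultiplicity U (fun X : U => pHat (X : z × v) / nHat (X : z × v)) 2 := by
  have hdim : finrank ℝ z = 4 := by simpa using finrank_eq_card_basis b.toBasis
  have hn : (4 : ℕ) ≤ 7 := by norm_num
  obtain ⟨θ, -, hθ⟩ := exists_isOctonionCopy (v := v) b hn (by norm_num) (W := ⊤) top_ne_bot
    (fun _ _ _ => Submodule.mem_top)
  have hframe := isComplementFrame_stdEmbedding b hn (g := ![4, 5, 6]) (by decide) (by decide)
  have hp : ∀ Y : z, pHat (Y, θ octOne) = (stdEmbedding b hn Y).fst.imI ^ 2 +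
      (stdEmbedding b hn Y).fst.imJ ^ 2 + (stdEmbedding b hn Y).fst.imK ^ 2 := by
    intro Y
    have hY := hθ.isIm Y
    have hsw := fun i j => congrArg (· ^ 2) (octForm_swap octOne _ hY (isImOctonion_imUnit i)
      (isImOctonion_imUnit j))
    simp only [neg_sq] at hsw
    rw [hθ.pHat_map hframe (by simp [hdim]), hdim]
    simp only [Fin.sum_univ_three, Function.comp_apply, Matrix.cons_val]
    rw [octForm_self octOne hY (isImOctonion_imUnit 4),
      octForm_self octOne hY (isImOctonion_imUnit 5),
      octForm_self octOne hY (isImOctonion_imUnit 6), hsw 5 4, hsw 6 5, hsw 4 6,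
      octForm_octOne_plane hY, (octForm_octOne_triple hY).1, (octForm_octOne_triple hY).2,
      Fintype.card_fin]
    push_cast
    ring
  have hp0 : pHat (b 0, θ octOne) ≠ 0 := by
    rw [hp, stdEmbedding_apply]
    simp [imUnit]
  have hp3 : pHat (b 3, θ octOne) = 0 := by
    rw [hp, stdEmbedding_apply]
    simp [imUnit]
  have hN3 : nHat (b 3, θ octOne) = 1 := by
    rw [nHat, θ.inner_map_map, inner_octOne_self, real_inner_self_eq_norm_sq, b.norm_eq_one]
    norm_num
  -- One of the two pairs is absent in dimension four, so the quadratic equation reduces to `c * (c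
  -- - p / N) = 0`.
  have hq : ∀ X : z × v, X.1 ≠ 0 → X.2 ≠ 0 → qHat X = 0 := by
    intro X hX hX2
    obtain ⟨s, t, -, -, h4, -, hq, -⟩ := exists_spectrum (by omega) hX
    rw [h4 hdim.le, mul_zero, eq_comm, div_eq_zero_iff] at hq
    exact hq.resolve_right (pow_ne_zero _ (nHat_pos hX hX2).ne')
  have hq3 : qHat (b 3, θ octOne) = 0 := by
    refine hq _ (b.orthonormal.ne_zero _) fun h => ?_
    have h2 := inner_octOne_self
    have h3 : θ octOne = 0 := h
    rw [← θ.inner_map_map, h3, inner_zero_left] at h2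
    exact zero_ne_one h2
  have hbr : IsEigenvalueBranch U (fun X : U => pHat (X : z × v) / nHat (X : z × v)) := by
    refine ⟨fun X => ?_, fun X => pHat X / nHat X, fun X hX => ?_, fun X => rfl⟩
    · have hreg := hU.subset X.2
      refine hasEigenvalue_of_root (by omega) hreg.1 ?_
      rw [hq _ hreg.1 hreg.2.1]
      ring
    · have hreg := hU.subset hX
      exact (analyticAt_pHat X).div (analyticAt_nHat X) (nHat_pos hreg.1 hreg.2.1).ne'
  have hne : ∀ X : U, pHat (X : z × v) / nHat (X : z × v) ≠ 0 := fun X => by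
    have hreg := hU.subset X.2
    exact div_ne_zero (pHat_ne_zero_of_mem_regularSet hdim.le hp0 hreg)
      (nHat_pos hreg.1 hreg.2.1).ne'
  refine ⟨nonzeroBranches_eq_singleton hU.isPreconnected hU.nonempty hbr ?_ hne,
    isNonconstant_of_root (by omega) hU hbr hne fun c hc => ⟨(b 3, θ octOne), ?_⟩, ?_⟩
  · intro X r hr
    obtain ⟨s, t, -, -, h4, hs, -, hev, -⟩ :=
      exists_spectrum (by omega) (hU.subset X.2).1
    rw [h4 hdim.le, add_zero] at hs
    rw [← hs]
    have := (hev r).1 hr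
    rw [h4 hdim.le] at this
    tauto
  · rw [hp3, hq3, hN3]
    simpa using hc
  · intro X
    obtain ⟨s, t, -, -, h4, hs, -, -, hfin⟩ :=
      exists_spectrum (by omega) (hU.subset X.2).1
    rw [h4 hdim.le, add_zero] at hs
    rw [hfin _ (hne X), h4 hdim.le, if_pos hs.symm, if_neg (hne X)]

omit [FiniteDimensional ℝ z] [FiniteDimensional ℝ v] [IsOrthogonalCliffordModule z v]
  [Module (Cl z) v] [IsScalarTower ℝ (Cl z) v] in
theorem inner_rightMul₂_sq (x Y : Octonion) {A B : Octonion}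
    (hA : IsImOctonion A) :
    (inner ℝ (rightMul₂ A B x) (octMul x Y) : ℝ) ^ 2 = octForm x Y A B ^ 2 := by
  rw [rightMul₂, inner_octMul_left_of_isIm _ _ hA, neg_sq, octForm, real_inner_comm]

theorem pHat_eq_muHatFour (hdim : finrank ℝ z = 4) {φ : z →ₗᵢ[ℝ] Octonion}
    {ψ : v ≃ₗᵢ[ℝ] Octonion} {E : Fin 3 → Octonion} (h : IsOctonionModel φ ψ)
    (hE : IsComplementFrame φ E) (X : z × v) : pHat X = muHatFour φ ψ E X := by
  have h1 := h.isOctonionCopy.pHat_map hE (by simp [hdim]) X.1 (ψ X.2)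
  have hX : (X.1, ψ.symm.toLinearIsometry (ψ X.2)) = X := by simp
  have hY := h.isIm X.1
  have hI := fun i => (hE.2 i).1
  have hsw := fun i j => congrArg (· ^ 2) (octForm_swap (ψ X.2) _ hY (hI i) (hI j))
  simp only [neg_sq] at hsw
  rw [hX, hdim, Fintype.card_fin] at h1
  rw [h1, muHatFour, inner_rightMul₂_sq _ _ (hI _), inner_rightMul₂_sq _ _ (hI _),
    inner_rightMul₂_sq _ _ (hI _)]
  -- Each unordered pair of frame vectors is counted twice, which cancels the factor one half in
  -- `pHat`.
  simp only [Fin.sum_univ_three, octForm_self _ hY (hI _), hsw 1 0, hsw 2 1, hsw 0 2]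
  push_cast
  ring

theorem pHat_eq_add_muHatFive (hdim : finrank ℝ z = 5) {φ : z →ₗᵢ[ℝ] Octonion}
    {ψ : v ≃ₗᵢ[ℝ] Octonion} {E : Fin 2 → Octonion} (h : IsOctonionModel φ ψ)
    (hE : IsComplementFrame φ E) (X : z × v) : pHat X = nHat X + muHatFive φ ψ E X := by
  have h1 := h.isOctonionCopy.pHat_map hE (by simp [hdim]) X.1 (ψ X.2)
  have hX : (X.1, ψ.symm.toLinearIsometry (ψ X.2)) = X := by simp
  have hY := h.isIm X.1
  have hI := fun i => (hE.2 i).1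
  have hsw := congrArg (· ^ 2) (octForm_swap (ψ X.2) _ hY (hI 1) (hI 0))
  simp only [neg_sq] at hsw
  rw [hX, hdim, Fintype.card_fin] at h1
  rw [h1, muHatFive, real_inner_comm, inner_rightMul₂_sq _ _ (hI _)]
  simp only [Fin.sum_univ_two, octForm_self _ hY (hI _), hsw]
  push_cast
  ring

omit [IsOrthogonalCliffordModule z v] in
theorem isGlobalEigenvalue_one
    (h : ∀ X : z × v, (negKHatSq X).HasEigenvalue (nHat X)) : IsGlobalEigenvalue z v 1 := by
  intro X
  rw [one_mul, ← nHat_eq]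
  exact h X

omit [IsOrthogonalCliffordModule z v] in
theorem hasEigenvalue_one {X : z × v} (hX₁ : X.1 ≠ 0) (hX₂ : X.2 ≠ 0)
    (h : (negKHatSq X).HasEigenvalue (nHat X)) : (negKCheckSq X).HasEigenvalue 1 := by
  obtain ⟨A, hA⟩ := h.exists_hasEigenvector
  refine End.hasEigenvalue_of_hasEigenvector (x := A) ⟨?_, hA.2⟩
  rw [End.mem_eigenspace_iff, negKCheckSq_eq, LinearMap.smul_apply, hA.apply_eq_smul, smul_smul,
    inv_mul_cancel₀ (nHat_pos hX₁ hX₂).ne']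

omit [IsOrthogonalCliffordModule z v] in
theorem nHat_eigenvalue_of_eq_zero {y : z} (hy : y ≠ 0) {X : z × v} (hX : X.1 = 0 ∨ X.2 = 0) :
    (negKHatSq X).HasEigenvalue (nHat X) := by
  have hK : kHat X = 0 := by
    ext A
    refine ext_inner_right ℝ fun B => ?_
    rw [inner_kHat]
    rcases hX with h | h <;> simp [h]
  have hN : nHat X = 0 := by
    rw [nHat]
    rcases hX with h | h <;> simp [h]
  refine End.hasEigenvalue_of_hasEigenvector (x := y) ⟨?_, hy⟩
  rw [End.mem_eigenspace_iff, hN, negKHatSq, hK]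
  simp

/-- In dimension five, an irreducible module has the branches `1` and `p̂ / n̂ - 1`. -/
theorem branches_of_five (b : OrthonormalBasis (Fin 5) ℝ z) (hv : IsSimpleModule (Cl z) v) :
    IsGlobalEigenvalueOfMultiplicity z v 1 2 ∧
      ∀ U : Set (z × v), IsRegularComponent U →
        nonzeroBranches U = {fun _ => 1, fun X : U => pHat (X : z × v) / nHat (X : z × v) - 1} ∧
        IsNonconstant U (fun X : U => pHat (X : z × v) / nHat (X : z × v) - 1) ∧
        HasMultiplicity U (fun X : U => pHat (X : z × v) / nHat (X : z × v) - 1) 2 := by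
  have hdim : finrank ℝ z = 5 := by simpa using finrank_eq_card_basis b.toBasis
  have hn6 : finrank ℝ z ≤ 6 := by omega
  have hn : (5 : ℕ) ≤ 7 := by norm_num
  obtain ⟨ψ, hψ⟩ := exists_isOctonionModel b hn (by norm_num) hv
  have hframe := isComplementFrame_stdEmbedding b hn (g := ![5, 6]) (by decide) (by decide)
  have hθ := hψ.isOctonionCopy
  set θ := ψ.symm.toLinearIsometry
  have hev : ∀ X : z × v, (negKHatSq X).HasEigenvalue (nHat X) := fun X =>
    hθ.hasEigenvalue_nHat hframe (by simp [hdim]) hdim X ⟨ψ X.2, by simp [θ]⟩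
  have hp : ∀ Y : z, pHat (Y, θ octOne) =
      inner ℝ Y Y + (stdEmbedding b hn Y).fst.imI ^ 2 := by
    intro Y
    have hY := hθ.isIm Y
    have hsw := congrArg (· ^ 2) (octForm_swap octOne _ hY (isImOctonion_imUnit 6)
      (isImOctonion_imUnit 5))
    simp only [neg_sq] at hsw
    rw [hθ.pHat_map hframe (by simp [hdim]), hdim, nHat, θ.inner_map_map, inner_octOne_self]
    simp only [Fin.sum_univ_two, Function.comp_apply, Matrix.cons_val_zero, Matrix.cons_val_one]
    rw [octForm_self octOne hY (isImOctonion_imUnit 5),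
      octForm_self octOne hY (isImOctonion_imUnit 6), hsw, octForm_octOne_plane hY,
      Fintype.card_fin]
    push_cast
    ring
  have hN : ∀ Y : z, nHat (Y, θ octOne) = inner ℝ Y Y := by
    intro Y
    rw [nHat, θ.inner_map_map, inner_octOne_self]
    ring
  have hθ0 : θ octOne ≠ 0 := by
    intro h
    have h2 := inner_octOne_self
    rw [← θ.inner_map_map, h, inner_zero_left] at h2
    exact zero_ne_one h2
  have hbb : ∀ i j, inner ℝ (b i) (b j) = if i = j then (1 : ℝ) else 0 :=
    orthonormal_iff_ite.1 b.orthonormal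
  have hY₀ : inner ℝ ((3 : ℝ) • b 0 + (4 : ℝ) • b 1) ((3 : ℝ) • b 0 + (4 : ℝ) • b 1) =
      (25 : ℝ) := by
    simp only [inner_add_left, inner_add_right, real_inner_smul_left, real_inner_smul_right, hbb]
    norm_num
  have hdisc : ∃ X₀ : z × v, qHat X₀ * (pHat X₀ ^ 2 - 4 * qHat X₀) ≠ 0 := by
    -- Above `octOne` the nonconstant eigenvalue is the squared first coordinate of `Y` divided by
    -- `‖Y‖²`. This `Y` gives `9 / 25`, different from both `0` and `1`.
    refine ⟨((3 : ℝ) • b 0 + (4 : ℝ) • b 1, θ octOne), ?_⟩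
    have hp0 : pHat ((3 : ℝ) • b 0 + (4 : ℝ) • b 1, θ octOne) = 34 := by
      rw [hp, hY₀, map_add, map_smul, map_smul, stdEmbedding_apply, stdEmbedding_apply]
      simp [imUnit]
      norm_num
    have hN0 : nHat ((3 : ℝ) • b 0 + (4 : ℝ) • b 1, θ octOne) = 25 := by rw [hN, hY₀]
    have hY0 : (3 : ℝ) • b 0 + (4 : ℝ) • b 1 ≠ 0 := by
      intro h
      rw [h, inner_zero_left] at hY₀
      norm_num at hY₀
    have hroot := root_of_hasEigenvalue hn6 (X := ((3 : ℝ) • b 0 + (4 : ℝ) • b 1, θ octOne)) hY0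
      hθ0 one_ne_zero (hasEigenvalue_one hY0 hθ0 (hev _))
    rw [hp0, hN0] at hroot
    have hq0 : qHat ((3 : ℝ) • b 0 + (4 : ℝ) • b 1, θ octOne) = 225 := by linarith
    rw [hp0, hq0]
    norm_num
  obtain ⟨X₀, hX₀⟩ := hdisc
  have hreg : ∀ X ∈ regularSet z v, (negKCheckSq X).HasEigenvalue 1 ∧
      (negKCheckSq X).HasEigenvalue (pHat X / nHat X - 1) ∧ pHat X / nHat X - 1 ≠ 0 ∧
      1 ≠ pHat X / nHat X - 1 := by
    intro X hX
    have hNpos := nHat_pos hX.1 hX.2.1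
    have h1 := hasEigenvalue_one hX.1 hX.2.1 (hev X)
    have hroot := root_of_hasEigenvalue hn6 hX.1 hX.2.1 one_ne_zero h1
    -- Since `1` is a root, the quadratic factors and the other root is `p / N - 1`.
    have hq : qHat X = nHat X * (pHat X - nHat X) := by linarith
    have hd := disc_ne_zero_of_mem_regularSet hn6 hX₀ hX
    rw [hq] at hd
    refine ⟨h1, hasEigenvalue_of_root hn6 hX.1 ?_, ?_, ?_⟩
    · rw [hq]
      field_simp
      ring
    · intro h
      rw [sub_eq_zero, div_eq_one_iff_eq hNpos.ne'] at h
      exact hd (by rw [h]; ring)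
    · intro h
      have h' : pHat X / nHat X = 2 := by linarith
      rw [div_eq_iff hNpos.ne'] at h'
      exact hd (by rw [h']; ring)
  refine ⟨⟨isGlobalEigenvalue_one hev, fun X hX => ?_⟩, fun U hU => ?_⟩
  · obtain ⟨h1, h2, h3, h4⟩ := hreg X hX
    exact (spectrum_of_two hn6 hX.1 h1 h2 one_ne_zero h3 h4).2.2.2.1
  · have hf : IsEigenvalueBranch U (fun _ => (1 : ℝ)) :=
      ⟨fun X => (hreg X (hU.subset X.2)).1, fun _ => 1, analyticOnNhd_const, fun _ => rfl⟩
    have hg : IsEigenvalueBranch U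
        (fun X : U => pHat (X : z × v) / nHat (X : z × v) - 1) := by
      refine ⟨fun X => (hreg X (hU.subset X.2)).2.1, fun X => pHat X / nHat X - 1,
        fun X hX => ?_, fun _ => rfl⟩
      have hXr := hU.subset hX
      exact ((analyticAt_pHat X).div (analyticAt_nHat X)
        (nHat_pos hXr.1 hXr.2.1).ne').sub analyticAt_const
    obtain ⟨hpair, -, hmult⟩ := pair_of_branches hn6 hU hf hg (fun _ => one_ne_zero)
      (fun X => (hreg X (hU.subset X.2)).2.2.1) (fun X => (hreg X (hU.subset X.2)).2.2.2)
    refine ⟨hpair, ?_, hmult⟩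
    rintro ⟨c, hc⟩
    -- The constant `1` solves the quadratic equation everywhere, so `isNonconstant_of_root` does
    -- not apply. Instead `p / N - 1` takes the values `1` over `b 0` and `0` over `b 1`.
    have hpc : ∃ X : z × v, pHat X - (c + 1) * nHat X ≠ 0 := by
      by_contra! hcon
      have h0 := hcon (b 0, θ octOne)
      have h1 := hcon (b 1, θ octOne)
      rw [hp, hN, stdEmbedding_apply, hbb] at h0 h1
      simp [imUnit] at h0 h1
      linarith
    obtain ⟨X₁, hX₁⟩ := hpc
    obtain ⟨X, hX, hne⟩ := hU.exists_ne_zero (f := fun X : z × v => pHat X - (c + 1) * nHat X)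
      (fun X => (analyticAt_pHat X).sub (analyticAt_const.mul (analyticAt_nHat X))) hX₁
    have h1 : pHat X / nHat X - 1 = c := hc ⟨X, hX⟩
    have hXr := hU.subset hX
    have h2 : pHat X / nHat X = c + 1 := by linarith
    rw [div_eq_iff (nHat_pos hXr.1 hXr.2.1).ne'] at h2
    exact hne (by rw [h2]; ring)

/-- In dimension six, an irreducible module has only the constant branch `1`. -/
theorem branches_of_six (b : OrthonormalBasis (Fin 6) ℝ z) (hv : IsSimpleModule (Cl z) v) :
    IsGlobalEigenvalueOfMultiplicity z v 1 4 ∧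
      ∀ U : Set (z × v), IsRegularComponent U → nonzeroBranches U = {fun _ => 1} := by
  have hdim : finrank ℝ z = 6 := by simpa using finrank_eq_card_basis b.toBasis
  have hn : (6 : ℕ) ≤ 7 := by norm_num
  obtain ⟨ψ, hψ⟩ := exists_isOctonionModel b hn (by norm_num) hv
  have hframe := isComplementFrame_stdEmbedding b hn (g := ![6]) (by decide) (by decide)
  have hθ := hψ.isOctonionCopy
  have hspec : ∀ X : z × v, X.1 ≠ 0 → X.2 ≠ 0 →
      (∀ r, (negKCheckSq X).HasEigenvalue r ↔ r = 0 ∨ r = 1) ∧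
      finrank ℝ ((negKCheckSq X).eigenspace 1) = 4 := by
    intro X hX₁ hX₂
    have hX : ∃ x, ψ.symm.toLinearIsometry x = X.2 := ⟨ψ X.2, by simp⟩
    obtain ⟨s, t, -, -, -, hp, -, hev, hfin⟩ := exists_spectrum hdim.le hX₁
    have hcard : finrank ℝ z + Fintype.card (Fin 1) = 7 := by simp [hdim]
    have hs1 := hθ.hasEigenvalue_le_one hframe hcard hX₁ hX₂ hX
      ((hev s).2 (Or.inr (Or.inl rfl)))
    have ht1 := hθ.hasEigenvalue_le_one hframe hcard hX₁ hX₂ hX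
      ((hev t).2 (Or.inr (Or.inr rfl)))
    -- The complement is a line, on which the skew form vanishes. Then `s + t = 2` together with `s,
    -- t ≤ 1` leaves only `s = t = 1`, with multiplicity `2 + 2`.
    have hp2 : pHat X = 2 * nHat X := by
      obtain ⟨x, hx⟩ := hX
      have h1 := hθ.pHat_map hframe hcard X.1 x
      rw [hx, hdim] at h1
      simp only [Fin.sum_univ_one, Function.comp_apply, Matrix.cons_val_fin_one] at h1
      rw [octForm_self x (hθ.isIm X.1) (isImOctonion_imUnit 6), Fintype.card_fin] at h1
      push_cast at h1
      have hX' : ((X.1, X.2) : z × v) = X := rfl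
      rw [hX'] at h1
      linarith
    rw [hp2, mul_div_assoc, div_self (nHat_pos hX₁ hX₂).ne'] at hp
    obtain rfl : s = 1 := by linarith
    obtain rfl : t = 1 := by linarith
    refine ⟨fun r => ?_, by rw [hfin 1 one_ne_zero]; simp⟩
    rw [hev]
    tauto
  refine ⟨⟨isGlobalEigenvalue_one fun X => ?_, fun X hX => (hspec X hX.1 hX.2.1).2⟩,
    fun U hU => ?_⟩
  -- A global eigenvalue is also tested where the rescaling is undefined; there `kHat` and `nHat`
  -- both vanish and any nonzero vector is an eigenvector.
  · by_cases hX : X.1 = 0 ∨ X.2 = 0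
    · exact nHat_eigenvalue_of_eq_zero (b.orthonormal.ne_zero 0) hX
    · push Not at hX
      have hN := (nHat_pos hX.1 hX.2).ne'
      obtain ⟨A, hA⟩ := (((hspec X hX.1 hX.2).1 1).2 (Or.inr rfl)).exists_hasEigenvector
      refine End.hasEigenvalue_of_hasEigenvector (x := A) ⟨?_, hA.2⟩
      have h1 := hA.apply_eq_smul
      rw [negKCheckSq_eq, LinearMap.smul_apply, one_smul] at h1
      rw [End.mem_eigenspace_iff]
      nth_rewrite 2 [← h1]
      rw [smul_inv_smul₀ hN]
  · refine nonzeroBranches_eq_singleton hU.isPreconnected hU.nonempty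
      ⟨fun X => ?_, fun _ => 1, analyticOnNhd_const, fun _ => rfl⟩ (fun X r hr => ?_)
      fun _ => one_ne_zero
    · have hX := hU.subset X.2
      exact ((hspec X hX.1 hX.2.1).1 1).2 (Or.inr rfl)
    · have hX := hU.subset X.2
      exact ((hspec X hX.1 hX.2.1).1 r).1 hr

end Dimensions

theorem exists_orthonormalBasis_fin {z : Type*} [NormedAddCommGroup z] [InnerProductSpace ℝ z]
    [FiniteDimensional ℝ z] {n : ℕ} (h : Module.finrank ℝ z = n) :
    Nonempty (OrthonormalBasis (Fin n) ℝ z) :=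
  ⟨(stdOrthonormalBasis ℝ z).reindex (finCongr h)⟩

theorem proposition5p3 {z v : Type*}
    [NormedAddCommGroup z] [InnerProductSpace ℝ z] [FiniteDimensional ℝ z]
    [NormedAddCommGroup v] [InnerProductSpace ℝ v] [FiniteDimensional ℝ v] [Nontrivial v]
    [Module (Cl z) v] [IsScalarTower ℝ (Cl z) v] [IsOrthogonalCliffordModule z v] :
    -- dimension 4
    (Module.finrank ℝ z = 4 →
      (∀ U : Set (z × v), IsRegularComponent U →
        ∃ μ : U → ℝ, nonzeroBranches U = {μ} ∧ IsNonconstant U μ ∧ HasMultiplicity U μ 2) ∧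
      (IsSimpleModule (Cl z) v →
        (∃ (φ : z →ₗᵢ[ℝ] Octonion) (ψ : v ≃ₗᵢ[ℝ] Octonion), IsOctonionModel φ ψ) ∧
        ∀ (φ : z →ₗᵢ[ℝ] Octonion) (ψ : v ≃ₗᵢ[ℝ] Octonion) (E : Fin 3 → Octonion),
          IsOctonionModel φ ψ → IsComplementFrame φ E →
          ∀ U : Set (z × v), IsRegularComponent U →
            nonzeroBranches U = {rescaled U (muHatFour φ ψ E)})) ∧
    -- dimension 5
    (Module.finrank ℝ z = 5 →
      (IsSimpleModule (Cl z) v →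
        IsGlobalEigenvalueOfMultiplicity z v 1 2 ∧
        (∀ U : Set (z × v), IsRegularComponent U →
          ∃ μ : U → ℝ, nonzeroBranches U = {fun _ => 1, μ} ∧
            IsNonconstant U μ ∧ HasMultiplicity U μ 2) ∧
        (∃ (φ : z →ₗᵢ[ℝ] Octonion) (ψ : v ≃ₗᵢ[ℝ] Octonion), IsOctonionModel φ ψ) ∧
        ∀ (φ : z →ₗᵢ[ℝ] Octonion) (ψ : v ≃ₗᵢ[ℝ] Octonion) (E : Fin 2 → Octonion),
          IsOctonionModel φ ψ → IsComplementFrame φ E →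
          ∀ U : Set (z × v), IsRegularComponent U →
            nonzeroBranches U = {fun _ => 1, rescaled U (muHatFive φ ψ E)}) ∧
      (IsSplitModule z v →
        ∀ U : Set (z × v), IsRegularComponent U →
          ∃ μ₁ μ₂ : U → ℝ, μ₁ ≠ μ₂ ∧ nonzeroBranches U = {μ₁, μ₂} ∧
            IsNonconstant U μ₁ ∧ IsNonconstant U μ₂ ∧
            HasMultiplicity U μ₁ 2 ∧ HasMultiplicity U μ₂ 2)) ∧
    -- dimension 6
    (Module.finrank ℝ z = 6 →
      (IsSimpleModule (Cl z) v →
        IsGlobalEigenvalueOfMultiplicity z v 1 4 ∧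
        ∀ U : Set (z × v), IsRegularComponent U → nonzeroBranches U = {fun _ => 1}) ∧
      (IsSplitModule z v →
        ∀ U : Set (z × v), IsRegularComponent U →
          ∃ μ₁ μ₂ : U → ℝ, μ₁ ≠ μ₂ ∧ nonzeroBranches U = {μ₁, μ₂} ∧
            IsNonconstant U μ₁ ∧ IsNonconstant U μ₂ ∧
            HasMultiplicity U μ₁ 2 ∧ HasMultiplicity U μ₂ 2)) := by
  refine ⟨fun h4 => ?_, fun h5 => ?_, fun h6 => ?_⟩
  · obtain ⟨b⟩ := exists_orthonormalBasis_fin h4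
    refine ⟨fun U hU => ⟨_, branches_of_four b hU⟩, fun hv => ⟨?_, fun φ ψ E hM hE U hU => ?_⟩⟩
    · exact ⟨_, exists_isOctonionModel b (by norm_num) (by norm_num) hv⟩
    · rw [(branches_of_four b hU).1]
      congr 1
      funext X
      rw [rescaled, ← nHat_eq, pHat_eq_muHatFour h4 hM hE]
  · obtain ⟨b⟩ := exists_orthonormalBasis_fin h5
    refine ⟨fun hv => ?_, fun hv U hU => branches_of_split b (Or.inl rfl) hv hU⟩
    obtain ⟨hglobal, hbr⟩ := branches_of_five b hv
    refine ⟨hglobal, fun U hU => ⟨_, hbr U hU⟩, ?_, fun φ ψ E hM hE U hU => ?_⟩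
    · exact ⟨_, exists_isOctonionModel b (by norm_num) (by norm_num) hv⟩
    · rw [(hbr U hU).1]
      congr 2
      funext X
      have hX := hU.subset X.2
      have hN := (nHat_pos hX.1 hX.2.1).ne'
      rw [rescaled, ← nHat_eq, pHat_eq_add_muHatFive h5 hM hE]
      field_simp
      ring
  · obtain ⟨b⟩ := exists_orthonormalBasis_fin h6
    exact ⟨branches_of_six b, fun hv U hU => branches_of_split b (Or.inr rfl) hv hU⟩
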